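/- Fix $L>4\pi$. For $0<k<1$ let $K(k)=\int_0^{\pi/2}(1-k^2\sin^2\theta)^{-1/2}\,d\theta$, let $\mathrm{CN}(\cdot,k)$ be Jacobi's cnoidal elliptic function of modulus $k$, and let $k_L\in(0,1)$ be the unique solution in $(0,1)$ of $64K^2(k_L)\sqrt{k_L^4-k_L^2+1}=L^2$ (which exists). For $k\in(0,k_L)$ put $\tilde m(k)=L^2-64K^2(k)\sqrt{k^4-k^2+1}$, $c(k)=L^2/\tilde m(k)$, $$A(k)=\frac{-204800K^6(k)}{27\tilde m^3(k)}\left(\sqrt{k^4-k^2+1}-(2k^2-1)\right)^2\left(2\sqrt{k^4-k^2+1}+(2k^2-1)\right),$$ $$\phi_k(x)=\left[\frac{5}{12}\left(\frac{L^2-64(2k^2-1)K^2(k)}{\tilde m(k)}-1\right)+\frac{80k^2K^2(k)}{\tilde m(k)}\,\mathrm{CN}^2\!\left(\frac{2K(k)}{L}x,k\right)\right]^2,$$ $\mathcal L_kf=-c(k)f''+(c(k)-1)f-\frac32\phi_k^{1/2}f$ for $L$-periodic $f$, and, for $u\in H^1_{per}([0,L])$, $$M_k(u)=c'(k)\,\frac12\int_0^L(u^2+u_x^2)\,dx+A'(k)\int_0^Lu\,dx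 .$$ Then, for every $k\in(0,k_L)$, $c$ and $A$ are differentiable at $k$, the derivative $\frac{\partial\phi_k}{\partial k}$ exists at every point and is a smooth $L$-periodic function, the functional $M_k$ is Fréchet differentiable at $\phi_k$ on $H^1_{per}([0,L])$ with derivative represented in $L^2_{per}([0,L])$ by a function $M_k'(\phi_k)$, and $$\Phi:=\left\langle\mathcal L_k\Big(\frac{\partial\phi_k}{\partial k}\Big),\frac{\partial\phi_k}{\partial k}\right\rangle=-\Big(M_k'(\phi_k),\frac{\partial\phi_k}{\partial k}\Big)_{L^2_{per}}<0 .$$ Here $\langle\cdot,\cdot\rangle$ is the $H^{-1}_{per}$-$H^1_{per}$ duality pairing, which in this case is $\int_0^L \mathcal L_k(\partial_k\phi_k)\,\partial_k\phi_k\,dx$. -/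

import Mathlib

open Set MeasureTheory
open scoped ContDiff

namespace CnoidalBBM

noncomputable section

/-! ### Elliptic integrals and the cnoidal function (modulus `k`) -/

/-- Incomplete elliptic integral of the first kind `F(φ, k) = ∫₀^φ dθ / √(1 - k² sin² θ)`. -/
def ellipticF (k φ : ℝ) : ℝ :=
  ∫ θ in (0 : ℝ)..φ, 1 / Real.sqrt (1 - k ^ 2 * Real.sin θ ^ 2)

/-- Complete elliptic integral of the first kind `K(k) = F(π/2, k)`. -/
def ellipticK (k : ℝ) : ℝ := ellipticF k (Real.pi / 2)

/-- Jacobi amplitude: the inverse function of `φ ↦ F(φ, k)`, which for `0 < k < 1` is a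
bijection of `ℝ`. -/
def jacobiAm (k : ℝ) : ℝ → ℝ := Function.invFun (ellipticF k)

/-- Jacobi's cnoidal function `CN(u, k) = cos am(u, k)`. -/
def jacobiCN (u k : ℝ) : ℝ := Real.cos (jacobiAm k u)

/-! ### The curve of periodic travelling waves -/

/-- `g(k) = 64 K(k)² √(k⁴ - k² + 1)`; the endpoint `k_L` is given by `g(k_L) = L²`. -/
def thresholdFun (k : ℝ) : ℝ := 64 * ellipticK k ^ 2 * Real.sqrt (k ^ 4 - k ^ 2 + 1)

/-- `m̃(k) = L² - 64 K(k)² √(k⁴ - k² + 1)`. -/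
def mTilde (L k : ℝ) : ℝ := L ^ 2 - 64 * ellipticK k ^ 2 * Real.sqrt (k ^ 4 - k ^ 2 + 1)

/-- The wave speed `c(k)`. -/
def waveSpeed (L k : ℝ) : ℝ := L ^ 2 / mTilde L k

/-- The integration constant `A(k)`. -/
def intConst (L k : ℝ) : ℝ :=
  -204800 * ellipticK k ^ 6 / (27 * mTilde L k ^ 3) *
    ((Real.sqrt (k ^ 4 - k ^ 2 + 1) - (2 * k ^ 2 - 1)) ^ 2 *
      (2 * Real.sqrt (k ^ 4 - k ^ 2 + 1) + (2 * k ^ 2 - 1)))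

/-- The periodic wave `φ_k(x)`. -/
def wave (L k x : ℝ) : ℝ :=
  (5 / 12 * ((L ^ 2 - 64 * (2 * k ^ 2 - 1) * ellipticK k ^ 2) / mTilde L k - 1) +
    80 * k ^ 2 * ellipticK k ^ 2 / mTilde L k *
      jacobiCN (2 * ellipticK k / L * x) k ^ 2) ^ 2

/-- The function `∂φ_k/∂k`. -/
def waveDk (L k : ℝ) : ℝ → ℝ := fun x => deriv (fun κ => wave L κ x) k

/-! ### `L²_per` and `H¹_per` -/

/-- The `L²_per([0,L])` inner product. On `L²_per × H¹_per` it is also the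
`H⁻¹_per`-`H¹_per` duality pairing. -/
def innerPer (L : ℝ) (f g : ℝ → ℝ) : ℝ := ∫ x in (0 : ℝ)..L, f x * g x

/-- `f` is `L`-periodic and square integrable over a period. -/
def MemL2per (L : ℝ) (f : ℝ → ℝ) : Prop :=
  Function.Periodic f L ∧ MemLp f 2 (volume.restrict (Ioc 0 L))

/-- `u` is (the continuous representative of) an element of `H¹_per([0,L])`: it is `L`-periodic
and absolutely continuous, with a square integrable (a.e. defined) derivative. -/
def MemH1per (L : ℝ) (u : ℝ → ℝ) : Prop :=
  Function.Periodic u L ∧ AbsolutelyContinuousOnInterval u 0 L ∧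
    MemLp (deriv u) 2 (volume.restrict (Ioc 0 L))

/-- The norm of `H¹_per([0,L])`. -/
def normH1per (L : ℝ) (u : ℝ → ℝ) : ℝ :=
  Real.sqrt (∫ x in (0 : ℝ)..L, (u x ^ 2 + deriv u x ^ 2))

/-- The functional `M` on `H¹_per([0,L])` is Fréchet differentiable at `u ∈ H¹_per([0,L])`, and
its derivative is represented by `G ∈ L²_per([0,L])` through the `L²_per` inner product, that is,
`M'(u) = G`. -/
def HasGradientPer (L : ℝ) (M : (ℝ → ℝ) → ℝ) (G u : ℝ → ℝ) : Prop :=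
  MemH1per L u ∧ MemL2per L G ∧
    ∀ ε > 0, ∃ δ > 0, ∀ h : ℝ → ℝ, MemH1per L h → normH1per L h < δ →
      |M (u + h) - M u - innerPer L G h| ≤ ε * normH1per L h

/-! ### The conserved quantities and the linearized operator -/

/-- `Q(u) = ½ ∫₀ᴸ (u² + u_x²) dx`. -/
def functionalQ (L : ℝ) (u : ℝ → ℝ) : ℝ :=
  1 / 2 * ∫ x in (0 : ℝ)..L, (u x ^ 2 + deriv u x ^ 2)

/-- `V(u) = ∫₀ᴸ u dx`. -/
def functionalV (L : ℝ) (u : ℝ → ℝ) : ℝ := ∫ x in (0 : ℝ)..L, u x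

/-- `M_k(u) = c'(k) Q(u) + A'(k) V(u)`. -/
def functionalM (L k : ℝ) (u : ℝ → ℝ) : ℝ :=
  deriv (waveSpeed L) k * functionalQ L u + deriv (intConst L) k * functionalV L u

/-- `𝓛_k f = -c f'' + (c - 1) f - (3/2) φ_k^{1/2} f`. -/
def linOp (L k : ℝ) (f : ℝ → ℝ) : ℝ → ℝ := fun x =>
  -waveSpeed L k * deriv (deriv f) x + (waveSpeed L k - 1) * f x -
    3 / 2 * Real.sqrt (wave L k x) * f x

/-- `Φ = ⟨𝓛_k (∂φ_k/∂k), ∂φ_k/∂k⟩`. -/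
def quantityPhi (L k : ℝ) : ℝ := innerPer L (linOp L k (waveDk L k)) (waveDk L k)

end

end CnoidalBBM

namespace CnoidalBBM

noncomputable section

open Filter Topology

/-! Write P for `thresholdFun`, y = P/(L² - P) for `ampl`, a for `normConst`, v for `meanSq` and l
for `periodRate`. Then c = 1 + y, A = -y³a and φ_k = (yψ)², where the profile ψ satisfies ψ'² =
(P/L²)(ψ²/4 - ψ³/5 - a/2). Hence cφ'' = (c - 1)φ - φ^{3/2} + A. Differentiating this equation in k
gives 𝓛_k(∂_kφ) = -(c'(φ - φ'') + A') = -M_k'(φ_k) (`linOp_waveDk`), which is the identity for Φ.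
Pairing with ∂_kφ gives -Φ = c' dQ/dk + A' dV/dk, with Q and V evaluated along the curve of waves.

For the sign, integrating (ψⁿψ')' over a period expresses the moments of ψ through a and v, so
Q(φ_k) and V(φ_k) are explicit in y, a, v. The classical formulas for K' and E' close the system: y'
= -2la'y(1 + y) and v' = a'(1 + l(v - 6a)), where l is a function of a and v. It follows that -Φ is
L a'² y⁵ times a quadratic polynomial in c whose coefficients depend on a and v only. By
`speed_polynomial_pos` it is positive for c > 1: in suitable variables only its value at c = 1
contains a negative term, and the lower bound for v - 6a in `excess_bounds` absorbs it. That bound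
rests on E ≥ √(1 - k²) K.

The modulus k_L exists and is unique because P increases strictly (P' = -2Pla' with l > 0 > a'),
starts at P(0) = 16π² < L², and is unbounded as k → 1. -/

/-- Partial derivative in the first variable. -/
def pd1 (f : ℝ × ℝ → ℝ) (p : ℝ × ℝ) : ℝ := fderiv ℝ f p (1, 0)

/-- Partial derivative in the second variable. -/
def pd2 (f : ℝ × ℝ → ℝ) (p : ℝ × ℝ) : ℝ := fderiv ℝ f p (0, 1)

/-! ### Calculus on a strip `I ×ˢ univ`: modulus first, position second. -/

section Partial

theorem two_le_infty : (1 + 1 : WithTop ℕ∞) ≤ ∞ := by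
  have : ((2 : ℕ∞) : WithTop ℕ∞) ≤ ((⊤ : ℕ∞) : WithTop ℕ∞) := WithTop.coe_le_coe.2 le_top
  rw [one_add_one_eq_two]
  exact this

variable {I : Set ℝ} {f : ℝ × ℝ → ℝ}

theorem isOpen_strip (hI : IsOpen I) : IsOpen (I ×ˢ (univ : Set ℝ)) := hI.prod isOpen_univ

theorem strip_mem_nhds (hI : IsOpen I) {p : ℝ × ℝ} (hp : p.1 ∈ I) :
    I ×ˢ (univ : Set ℝ) ∈ 𝓝 p := (isOpen_strip hI).mem_nhds ⟨hp, mem_univ _⟩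

theorem hasDerivAt_fst {p : ℝ × ℝ} (hf : DifferentiableAt ℝ f p) :
    HasDerivAt (fun κ => f (κ, p.2)) (pd1 f p) p.1 := by
  have h : HasDerivAt (fun κ : ℝ => (κ, p.2)) ((1 : ℝ), (0 : ℝ)) p.1 :=
    (hasDerivAt_id p.1).prodMk (hasDerivAt_const _ _)
  exact hf.hasFDerivAt.comp_hasDerivAt p.1 h

theorem hasDerivAt_snd {p : ℝ × ℝ} (hf : DifferentiableAt ℝ f p) :
    HasDerivAt (fun x => f (p.1, x)) (pd2 f p) p.2 := by
  have h : HasDerivAt (fun x : ℝ => (p.1, x)) ((0 : ℝ), (1 : ℝ)) p.2 :=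
    (hasDerivAt_const _ _).prodMk (hasDerivAt_id p.2)
  exact hf.hasFDerivAt.comp_hasDerivAt p.2 h

theorem contDiffOn_fderiv_apply (hI : IsOpen I) (hf : ContDiffOn ℝ ∞ f (I ×ˢ univ)) (v : ℝ × ℝ) :
    ContDiffOn ℝ ∞ (fun p => fderiv ℝ f p v) (I ×ˢ univ) :=
  (hf.fderiv_of_isOpen (m := ∞) (isOpen_strip hI) (by simp)).clm_apply contDiffOn_const

theorem contDiffOn_pd1 (hI : IsOpen I) (hf : ContDiffOn ℝ ∞ f (I ×ˢ univ)) :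
    ContDiffOn ℝ ∞ (pd1 f) (I ×ˢ univ) := contDiffOn_fderiv_apply hI hf _

theorem contDiffOn_pd2 (hI : IsOpen I) (hf : ContDiffOn ℝ ∞ f (I ×ˢ univ)) :
    ContDiffOn ℝ ∞ (pd2 f) (I ×ˢ univ) := contDiffOn_fderiv_apply hI hf _

theorem differentiableAt_of_contDiffOn_strip (hI : IsOpen I)
    (hf : ContDiffOn ℝ ∞ f (I ×ˢ univ)) {p : ℝ × ℝ} (hp : p.1 ∈ I) : DifferentiableAt ℝ f p :=
  (hf.contDiffAt (strip_mem_nhds hI hp)).differentiableAt (by simp)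

theorem contDiff_slice (hf : ContDiffOn ℝ ∞ f (I ×ˢ univ)) {k : ℝ} (hk : k ∈ I) :
    ContDiff ℝ ∞ (fun x => f (k, x)) := by
  rw [← contDiffOn_univ]
  exact hf.comp (by fun_prop) (fun x _ => ⟨hk, mem_univ _⟩)

/-- Schwarz's theorem; it lets ∂_k pass through ∂_x² when the wave equation is differentiated in the
modulus. -/
theorem pd1_pd2_comm (hI : IsOpen I) (hf : ContDiffOn ℝ ∞ f (I ×ˢ univ)) {p : ℝ × ℝ}
    (hp : p.1 ∈ I) : pd1 (pd2 f) p = pd2 (pd1 f) p := by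
  have hc : ContDiffAt ℝ ∞ f p := hf.contDiffAt (strip_mem_nhds hI hp)
  have hd : DifferentiableAt ℝ (fderiv ℝ f) p :=
    (hc.fderiv_right (m := 1) two_le_infty).differentiableAt (by simp)
  have key : ∀ v w : ℝ × ℝ, fderiv ℝ (fun q => fderiv ℝ f q v) p w
      = fderiv ℝ (fderiv ℝ f) p w v := fun v w => by
    rw [fderiv_clm_apply hd (by fun_prop)]; simp
  have hs : IsSymmSndFDerivAt ℝ f p := hc.isSymmSndFDerivAt (by
    rw [minSmoothness_of_isRCLikeNormedField, ← one_add_one_eq_two]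
    exact two_le_infty)
  change fderiv ℝ (fun q => fderiv ℝ f q (0, 1)) p (1, 0)
    = fderiv ℝ (fun q => fderiv ℝ f q (1, 0)) p (0, 1)
  rw [key, key]
  exact hs _ _

theorem hasDerivAt_integral_fst (hI : IsOpen I) (hf : ContDiffOn ℝ ∞ f (I ×ˢ univ))
    {k : ℝ} (hk : k ∈ I) (a b : ℝ) :
    HasDerivAt (fun κ => ∫ t in a..b, f (κ, t)) (∫ t in a..b, pd1 f (k, t)) k := by
  obtain ⟨r, hr, hrI⟩ := Metric.nhds_basis_closedBall.mem_iff.1 (hI.mem_nhds hk)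
  have hc : ContinuousOn (pd1 f) (I ×ˢ univ) := (contDiffOn_pd1 hI hf).continuousOn
  obtain ⟨C, hC⟩ := ((isCompact_closedBall k r).prod (isCompact_uIcc (a := a) (b := b))
    ).exists_bound_of_continuousOn (hc.mono (prod_mono hrI (subset_univ _)))
  have hcont : ∀ κ ∈ I, Continuous fun t => f (κ, t) := fun κ hκ => (contDiff_slice hf hκ).continuous
  refine (intervalIntegral.hasDerivAt_integral_of_dominated_loc_of_deriv_le
    (F := fun κ t => f (κ, t)) (F' := fun κ t => pd1 f (κ, t)) (bound := fun _ => C)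
    (Metric.closedBall_mem_nhds k hr) ?_ ?_ ?_ ?_ ?_ ?_).2
  · filter_upwards [hI.mem_nhds hk] with κ hκ using (hcont κ hκ).aestronglyMeasurable
  · exact (hcont k hk).intervalIntegrable _ _
  · exact (contDiff_slice (contDiffOn_pd1 hI hf) hk).continuous.aestronglyMeasurable
  · exact .of_forall fun t ht x hx => hC (x, t) ⟨hx, uIoc_subset_uIcc ht⟩
  · exact intervalIntegrable_const
  · exact .of_forall fun t ht x hx =>
      hasDerivAt_fst (p := (x, t)) (differentiableAt_of_contDiffOn_strip hI hf (hrI hx))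

theorem continuousOn_primitive_snd (hI : IsOpen I) (hf : ContinuousOn f (I ×ˢ univ)) :
    ContinuousOn (fun p : ℝ × ℝ => ∫ t in (0 : ℝ)..p.2, f (p.1, t)) (I ×ˢ univ) := by
  have h1 : Continuous (Function.uncurry fun (x : I) (t : ℝ) => f (x.1, t)) :=
    hf.comp_continuous (by fun_prop) (fun q => ⟨q.1.2, mem_univ _⟩)
  have h2 := intervalIntegral.continuous_parametric_primitive_of_continuous
    (μ := volume) (a₀ := 0) h1
  -- Since `I` is open, continuity over the subtype transfers to continuity at points of the plane.
  have he : IsOpenEmbedding (Prod.map (Subtype.val : I → ℝ) (id : ℝ → ℝ)) :=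
    hI.isOpenEmbedding_subtypeVal.prodMap .id
  rintro ⟨k, x⟩ ⟨hk, -⟩
  refine ContinuousAt.continuousWithinAt ?_
  exact (he.continuousAt_iff (g := fun p : ℝ × ℝ => ∫ t in (0 : ℝ)..p.2, f (p.1, t))
    (x := (⟨k, hk⟩, x))).1 h2.continuousAt

theorem hasFDerivAt_primitive_snd (hI : IsOpen I) (hf : ContDiffOn ℝ ∞ f (I ×ˢ univ))
    {p : ℝ × ℝ} (hp : p.1 ∈ I) :
    HasFDerivAt (fun p : ℝ × ℝ => ∫ t in (0 : ℝ)..p.2, f (p.1, t))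
      ((∫ t in (0 : ℝ)..p.2, pd1 f (p.1, t)) • ContinuousLinearMap.fst ℝ ℝ ℝ
        + f p • ContinuousLinearMap.snd ℝ ℝ ℝ) p := by
  have hev : ∀ᶠ v in 𝓝 p, v.1 ∈ I := continuousAt_fst.eventually (hI.mem_nhds hp)
  have h1 := continuousOn_primitive_snd hI (contDiffOn_pd1 hI hf).continuousOn
  have := (hasStrictFDerivAt_uncurry_coprod (𝕜 := ℝ) (u := p)
    (f := fun k x => ∫ t in (0 : ℝ)..x, f (k, t))
    (f₁ := fun k x => (∫ t in (0 : ℝ)..x, pd1 f (k, t)) • ContinuousLinearMap.id ℝ ℝ)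
    (f₂ := fun k x => f (k, x) • ContinuousLinearMap.id ℝ ℝ) ?_ ?_ ?_ ?_).hasFDerivAt
  · convert! this using 1
  · filter_upwards [hev] with v hv
    have := (hasDerivAt_integral_fst hI hf hv 0 v.2).hasFDerivAt
    convert! this using 1
    ext; simp [Function.HasUncurry.uncurry]
  · filter_upwards [hev] with v hv
    have hc := (contDiff_slice hf hv).continuous
    have := (intervalIntegral.integral_hasDerivAt_right (hc.intervalIntegrable 0 v.2)
      (hc.stronglyMeasurableAtFilter _ _) hc.continuousAt).hasFDerivAt
    convert! this using 1
    ext; simp [Function.HasUncurry.uncurry]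
  · exact (h1.continuousAt (strip_mem_nhds hI hp)).smul continuousAt_const
  · exact (hf.continuousOn.continuousAt (strip_mem_nhds hI hp)).smul continuousAt_const

/-- The partial derivatives of the primitive are the primitive of `pd1 f` and `f` itself, so
induction on the order closes once it is generalized over `f`. -/
theorem contDiffOn_primitive_snd (hI : IsOpen I) (hf : ContDiffOn ℝ ∞ f (I ×ˢ univ)) :
    ContDiffOn ℝ ∞ (fun p : ℝ × ℝ => ∫ t in (0 : ℝ)..p.2, f (p.1, t)) (I ×ˢ univ) := by
  rw [contDiffOn_infty]
  intro n
  induction n generalizing f with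
  | zero =>
    exact contDiffOn_zero.2 (continuousOn_primitive_snd hI hf.continuousOn)
  | succ n ih =>
    push_cast
    rw [contDiffOn_succ_iff_fderiv_of_isOpen (isOpen_strip hI)]
    refine ⟨fun p hp => (hasFDerivAt_primitive_snd hI hf hp.1).differentiableAt.differentiableWithinAt,
      by simp, ?_⟩
    have h : ContDiffOn ℝ n (fun p : ℝ × ℝ =>
        (∫ t in (0 : ℝ)..p.2, pd1 f (p.1, t)) • ContinuousLinearMap.fst ℝ ℝ ℝ
        + f p • ContinuousLinearMap.snd ℝ ℝ ℝ) (I ×ˢ univ) :=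
      ((ih (contDiffOn_pd1 hI hf)).smul contDiffOn_const).add
        ((hf.of_le (by exact_mod_cast le_top)).smul contDiffOn_const)
    exact h.congr fun p hp => (hasFDerivAt_primitive_snd hI hf hp.1).fderiv

end Partial

/-! ### Elliptic integrals -/

theorem one_sub_sq_mul_sin_sq_pos {k : ℝ} (hk : k ∈ Ioo (-1 : ℝ) 1) (θ : ℝ) :
    0 < 1 - k ^ 2 * Real.sin θ ^ 2 := by
  have h1 : k ^ 2 < 1 := by rw [sq_lt_one_iff_abs_lt_one]; exact abs_lt.2 hk
  nlinarith [Real.sin_sq_le_one θ, sq_nonneg (Real.sin θ), sq_nonneg k]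

/-- Legendre's `Δ(k, θ) = √(1 - k² sin² θ)`. -/
def legendreDelta (k θ : ℝ) : ℝ := Real.sqrt (1 - k ^ 2 * Real.sin θ ^ 2)

theorem legendreDelta_pos {k : ℝ} (hk : k ∈ Ioo (-1 : ℝ) 1) (θ : ℝ) : 0 < legendreDelta k θ :=
  Real.sqrt_pos.2 (one_sub_sq_mul_sin_sq_pos hk θ)

theorem legendreDelta_sq {k : ℝ} (hk : k ∈ Ioo (-1 : ℝ) 1) (θ : ℝ) :
    legendreDelta k θ ^ 2 = 1 - k ^ 2 * Real.sin θ ^ 2 :=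
  Real.sq_sqrt (one_sub_sq_mul_sin_sq_pos hk θ).le

theorem contDiffOn_legendreDelta :
    ContDiffOn ℝ ∞ (fun p : ℝ × ℝ => legendreDelta p.1 p.2) (Ioo (-1 : ℝ) 1 ×ˢ univ) := by
  have h : ContDiff ℝ ∞ (fun p : ℝ × ℝ => 1 - p.1 ^ 2 * Real.sin p.2 ^ 2) := by fun_prop
  exact h.contDiffOn.sqrt fun p hp => (one_sub_sq_mul_sin_sq_pos hp.1 p.2).ne'

theorem contDiffOn_one_div_legendreDelta :
    ContDiffOn ℝ ∞ (fun p : ℝ × ℝ => 1 / legendreDelta p.1 p.2) (Ioo (-1 : ℝ) 1 ×ˢ univ) :=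
  contDiffOn_const.div contDiffOn_legendreDelta fun p hp => (legendreDelta_pos hp.1 p.2).ne'

theorem continuous_legendreDelta (k : ℝ) : Continuous (legendreDelta k) := by
  unfold legendreDelta; fun_prop

theorem continuous_one_div_legendreDelta {k : ℝ} (hk : k ∈ Ioo (-1 : ℝ) 1) :
    Continuous fun θ => 1 / legendreDelta k θ :=
  continuous_const.div (continuous_legendreDelta k) fun θ => (legendreDelta_pos hk θ).ne'

theorem hasDerivAt_legendreDelta {k : ℝ} (hk : k ∈ Ioo (-1 : ℝ) 1) (θ : ℝ) :
    HasDerivAt (legendreDelta k)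
      (-(k ^ 2 * Real.sin θ * Real.cos θ) / legendreDelta k θ) θ := by
  have h : HasDerivAt (fun θ => 1 - k ^ 2 * Real.sin θ ^ 2)
      (-(k ^ 2 * (2 * Real.sin θ * Real.cos θ))) θ := by
    have := (((Real.hasDerivAt_sin θ).pow 2).const_mul (k ^ 2)).const_sub 1
    convert! this using 1
    norm_num
  convert! h.sqrt (one_sub_sq_mul_sin_sq_pos hk θ).ne' using 1
  change _ = _ / (2 * legendreDelta k θ)
  have := (legendreDelta_pos hk θ).ne'
  field_simp

theorem hasDerivAt_legendreDelta_modulus {k : ℝ} (hk : k ∈ Ioo (-1 : ℝ) 1) (θ : ℝ) :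
    HasDerivAt (fun κ => legendreDelta κ θ) (-(k * Real.sin θ ^ 2) / legendreDelta k θ) k := by
  have h : HasDerivAt (fun κ : ℝ => 1 - κ ^ 2 * Real.sin θ ^ 2)
      (-(2 * k * Real.sin θ ^ 2)) k := by
    have := ((hasDerivAt_pow 2 k).mul_const (Real.sin θ ^ 2)).const_sub 1
    convert! this using 1
    norm_num
  convert! h.sqrt (one_sub_sq_mul_sin_sq_pos hk θ).ne' using 1
  change _ = _ / (2 * legendreDelta k θ)
  have := (legendreDelta_pos hk θ).ne'
  field_simp

theorem contDiffOn_ellipticF :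
    ContDiffOn ℝ ∞ (fun p : ℝ × ℝ => ellipticF p.1 p.2) (Ioo (-1 : ℝ) 1 ×ˢ univ) :=
  contDiffOn_primitive_snd isOpen_Ioo contDiffOn_one_div_legendreDelta

theorem hasDerivAt_ellipticF {k : ℝ} (hk : k ∈ Ioo (-1 : ℝ) 1) (φ : ℝ) :
    HasDerivAt (ellipticF k) (1 / legendreDelta k φ) φ := by
  have hc := continuous_one_div_legendreDelta hk
  exact intervalIntegral.integral_hasDerivAt_right (hc.intervalIntegrable 0 φ)
    (hc.stronglyMeasurableAtFilter _ _) hc.continuousAt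

theorem ellipticF_zero (k : ℝ) : ellipticF k 0 = 0 := by simp [ellipticF]

theorem strictMono_ellipticF {k : ℝ} (hk : k ∈ Ioo (-1 : ℝ) 1) : StrictMono (ellipticF k) :=
  strictMono_of_hasDerivAt_pos (hasDerivAt_ellipticF hk)
    fun φ => one_div_pos.2 (legendreDelta_pos hk φ)

theorem legendreDelta_le_one (k θ : ℝ) : legendreDelta k θ ≤ 1 :=
  Real.sqrt_le_one.2 (by nlinarith [mul_nonneg (sq_nonneg k) (sq_nonneg (Real.sin θ))])

/-- The integrand is at least 1, so `ellipticF k` dominates the identity at both ends; surjectivity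
follows. -/
theorem monotone_ellipticF_sub_id {k : ℝ} (hk : k ∈ Ioo (-1 : ℝ) 1) :
    Monotone fun φ => ellipticF k φ - φ := by
  refine monotone_of_hasDerivAt_nonneg
    (fun φ => (hasDerivAt_ellipticF hk φ).sub (hasDerivAt_id φ)) fun φ => ?_
  rw [Pi.zero_apply, sub_nonneg]
  exact (one_le_div (legendreDelta_pos hk φ)).2 (legendreDelta_le_one k φ)

theorem surjective_ellipticF {k : ℝ} (hk : k ∈ Ioo (-1 : ℝ) 1) :
    Function.Surjective (ellipticF k) := by
  have hm := monotone_ellipticF_sub_id hk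
  refine Continuous.surjective
    (continuous_iff_continuousAt.2 fun φ => (hasDerivAt_ellipticF hk φ).continuousAt) ?_ ?_
  · refine tendsto_atTop_mono' _ ?_ tendsto_id
    filter_upwards [eventually_ge_atTop 0] with φ hφ
    have := hm hφ
    simp only [ellipticF_zero] at this
    simp only [id]; linarith
  · refine tendsto_atBot_mono' _ ?_ tendsto_id
    filter_upwards [eventually_le_atBot 0] with φ hφ
    have := hm hφ
    simp only [ellipticF_zero] at this
    simp only [id]; linarith

theorem integral_zero_pi_eq_two_mul {f : ℝ → ℝ} (hf : Continuous f)
    (hs : ∀ θ, f (Real.pi - θ) = f θ) :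
    ∫ θ in (0 : ℝ)..Real.pi, f θ = 2 * ∫ θ in (0 : ℝ)..(Real.pi / 2), f θ := by
  have h := intervalIntegral.integral_comp_sub_left (a := 0) (b := Real.pi / 2) f Real.pi
  simp only [hs, sub_zero, sub_half] at h
  rw [← intervalIntegral.integral_add_adjacent_intervals (hf.intervalIntegrable 0 (Real.pi / 2))
    (hf.intervalIntegrable _ _), ← h]
  ring

theorem legendreDelta_pi_sub (k θ : ℝ) : legendreDelta k (Real.pi - θ) = legendreDelta k θ := by
  simp [legendreDelta]

theorem legendreDelta_periodic (k : ℝ) : Function.Periodic (legendreDelta k) Real.pi := by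
  intro θ; simp [legendreDelta]

theorem ellipticF_add_pi {k : ℝ} (hk : k ∈ Ioo (-1 : ℝ) 1) (φ : ℝ) :
    ellipticF k (φ + Real.pi) = ellipticF k φ + 2 * ellipticK k := by
  have hc := continuous_one_div_legendreDelta hk
  have h1 : Function.Periodic (fun θ => 1 / legendreDelta k θ) Real.pi := fun θ => by
    simp only [legendreDelta_periodic k θ]
  have h2 := h1.intervalIntegral_add_eq φ 0
  rw [zero_add, integral_zero_pi_eq_two_mul hc
    (fun θ => by simp only [legendreDelta_pi_sub])] at h2
  have h3 := intervalIntegral.integral_add_adjacent_intervals (hc.intervalIntegrable 0 φ)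
    (hc.intervalIntegrable φ (φ + Real.pi)) (μ := volume)
  rw [h2] at h3
  exact h3.symm

/-! ### The amplitude -/

theorem ellipticF_jacobiAm {k : ℝ} (hk : k ∈ Ioo (-1 : ℝ) 1) (u : ℝ) :
    ellipticF k (jacobiAm k u) = u :=
  Function.rightInverse_invFun (surjective_ellipticF hk) u

theorem jacobiAm_ellipticF {k : ℝ} (hk : k ∈ Ioo (-1 : ℝ) 1) (φ : ℝ) :
    jacobiAm k (ellipticF k φ) = φ :=
  Function.leftInverse_invFun (strictMono_ellipticF hk).injective φ

theorem jacobiAm_zero {k : ℝ} (hk : k ∈ Ioo (-1 : ℝ) 1) : jacobiAm k 0 = 0 := by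
  have := jacobiAm_ellipticF hk 0
  rwa [ellipticF_zero] at this

theorem jacobiAm_add {k : ℝ} (hk : k ∈ Ioo (-1 : ℝ) 1) (u : ℝ) :
    jacobiAm k (u + 2 * ellipticK k) = jacobiAm k u + Real.pi := by
  rw [← jacobiAm_ellipticF hk (jacobiAm k u + Real.pi), ellipticF_add_pi hk,
    ellipticF_jacobiAm hk]

/-- Inverse function theorem for (k, φ) ↦ (k, F(φ, k)), whose derivative is triangular with diagonal
entries 1 and 1/Δ. -/
theorem contDiffOn_jacobiAm :
    ContDiffOn ℝ ∞ (fun p : ℝ × ℝ => jacobiAm p.1 p.2) (Ioo (-1 : ℝ) 1 ×ˢ univ) := by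
  rintro ⟨k, u⟩ ⟨hk : k ∈ Ioo (-1 : ℝ) 1, -⟩
  refine ContDiffAt.contDiffWithinAt ?_
  set φ := jacobiAm k u with hφ
  set G : ℝ × ℝ → ℝ × ℝ := fun p => (p.1, ellipticF p.1 p.2) with hG
  have hF : ContDiffAt ℝ ∞ (fun p : ℝ × ℝ => ellipticF p.1 p.2) (k, φ) :=
    contDiffOn_ellipticF.contDiffAt (strip_mem_nhds isOpen_Ioo hk)
  have hGc : ContDiffAt ℝ ∞ G (k, φ) := contDiffAt_fst.prodMk hF
  have hd : DifferentiableAt ℝ (fun p : ℝ × ℝ => ellipticF p.1 p.2) (k, φ) :=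
    hF.differentiableAt (by simp)
  set D := fderiv ℝ (fun p : ℝ × ℝ => ellipticF p.1 p.2) (k, φ) with hD
  have hD2 : D (0, 1) = 1 / legendreDelta k φ :=
    (hasDerivAt_snd (p := (k, φ)) hd).unique (hasDerivAt_ellipticF hk φ)
  have hne : D (0, 1) ≠ 0 := by rw [hD2]; exact (one_div_pos.2 (legendreDelta_pos hk φ)).ne'
  have hDab : ∀ a b : ℝ, D (a, b) = a * D (1, 0) + b * D (0, 1) := fun a b => by
    have : ((a, b) : ℝ × ℝ) = a • (1, 0) + b • (0, 1) := by simp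
    rw [this, map_add, map_smul, map_smul]; simp
  let e : (ℝ × ℝ) ≃L[ℝ] (ℝ × ℝ) := ContinuousLinearEquiv.equivOfInverse
    ((ContinuousLinearMap.fst ℝ ℝ ℝ).prod D)
    ((ContinuousLinearMap.fst ℝ ℝ ℝ).prod ((D (0, 1))⁻¹ •
      (ContinuousLinearMap.snd ℝ ℝ ℝ - D (1, 0) • ContinuousLinearMap.fst ℝ ℝ ℝ)))
    (by
      rintro ⟨a, b⟩
      ext
      · simp
      · simp only [ContinuousLinearMap.prod_apply, ContinuousLinearMap.coe_fst',
          FunLike.coe_smul, FunLike.coe_sub, Pi.smul_apply, Pi.sub_apply,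
          ContinuousLinearMap.coe_snd', smul_eq_mul]
        rw [hDab a b]; field_simp; ring)
    (by
      rintro ⟨a, b⟩
      ext
      · simp
      · simp only [ContinuousLinearMap.prod_apply, ContinuousLinearMap.coe_fst',
          FunLike.coe_smul, FunLike.coe_sub, Pi.smul_apply, Pi.sub_apply,
          ContinuousLinearMap.coe_snd', smul_eq_mul]
        rw [hDab]; field_simp; ring)
  have hGd : HasFDerivAt G (e : (ℝ × ℝ) →L[ℝ] (ℝ × ℝ)) (k, φ) :=
    hasFDerivAt_fst.prodMk hd.hasFDerivAt
  have hne' : (∞ : WithTop ℕ∞) ≠ 0 := by simp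
  have hinv := hGc.to_localInverse hGd hne'
  have hGu : G (k, φ) = (k, u) := by simp [hG, hφ, ellipticF_jacobiAm hk]
  have hright := (hGc.hasStrictFDerivAt' hGd hne').eventually_right_inverse
  rw [hGu] at hinv hright
  refine hinv.snd.congr_of_eventuallyEq ?_
  -- The local inverse keeps the modulus, and its second component is mapped by F to `q.2`;
  -- injectivity of F identifies it with the amplitude.
  filter_upwards [hright, strip_mem_nhds (p := (k, u)) isOpen_Ioo hk] with q hq hqI
  change G (hGc.localInverse hGd hne' q) = q at hq
  have h1 : (G (hGc.localInverse hGd hne' q)).1 = q.1 := by rw [hq]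
  have h2 : (G (hGc.localInverse hGd hne' q)).2 = q.2 := by rw [hq]
  simp only [hG] at h1 h2
  rw [h1] at h2
  rw [← h2, jacobiAm_ellipticF hqI.1]

theorem continuous_jacobiAm {k : ℝ} (hk : k ∈ Ioo (-1 : ℝ) 1) : Continuous (jacobiAm k) :=
  (contDiff_slice contDiffOn_jacobiAm hk).continuous

theorem hasDerivAt_jacobiAm {k : ℝ} (hk : k ∈ Ioo (-1 : ℝ) 1) (u : ℝ) :
    HasDerivAt (jacobiAm k) (legendreDelta k (jacobiAm k u)) u := by
  have h := HasDerivAt.of_local_left_inverse (continuous_jacobiAm hk).continuousAt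
    (hasDerivAt_ellipticF hk (jacobiAm k u))
    (one_div_pos.2 (legendreDelta_pos hk _)).ne'
    (.of_forall fun y => ellipticF_jacobiAm hk y)
  simpa using h

/-! ### Complete integrals -/

/-- Complete elliptic integral of the second kind. -/
def ellipticE (k : ℝ) : ℝ := ∫ θ in (0 : ℝ)..(Real.pi / 2), legendreDelta k θ

theorem ellipticK_pos {k : ℝ} (hk : k ∈ Ioo (-1 : ℝ) 1) : 0 < ellipticK k := by
  have := strictMono_ellipticF hk (half_pos Real.pi_pos)
  rwa [ellipticF_zero] at this

theorem contDiffOn_ellipticK : ContDiffOn ℝ ∞ ellipticK (Ioo (-1 : ℝ) 1) :=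
  contDiffOn_ellipticF.comp (t := Ioo (-1 : ℝ) 1 ×ˢ univ)
    (f := fun k : ℝ => (k, Real.pi / 2)) (by fun_prop) fun k hk => ⟨hk, mem_univ _⟩

/-- The difference of the integrands is the derivative of k² sin θ cos θ / Δ, which vanishes at 0
and π/2. This brings E into the formula for K'. -/
theorem integral_one_div_legendreDelta_pow_three {k : ℝ} (hk : k ∈ Ioo (-1 : ℝ) 1) :
    (1 - k ^ 2) * ∫ θ in (0 : ℝ)..(Real.pi / 2), 1 / legendreDelta k θ ^ 3 = ellipticE k := by
  have hd : ∀ θ, HasDerivAt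
      (fun θ => k ^ 2 * (Real.sin θ * Real.cos θ / legendreDelta k θ))
      (legendreDelta k θ - (1 - k ^ 2) * (1 / legendreDelta k θ ^ 3)) θ := fun θ => by
    have h := ((((Real.hasDerivAt_sin θ).mul (Real.hasDerivAt_cos θ)).div
      (hasDerivAt_legendreDelta hk θ) (legendreDelta_pos hk θ).ne')).const_mul (k ^ 2)
    convert! h using 1
    have hp := (legendreDelta_pos hk θ).ne'
    have hsq := legendreDelta_sq hk θ
    have hcs := Real.sin_sq_add_cos_sq θ
    set D := legendreDelta k θ
    have hc : Real.cos θ ^ 2 = 1 - Real.sin θ ^ 2 := by linarith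
    have hcc : Real.cos θ * Real.cos θ = 1 - Real.sin θ ^ 2 := by rw [← hc]; ring
    rw [Pi.mul_apply]
    field_simp
    rw [hc]
    have e1 : D ^ 4 = (1 - k ^ 2 * Real.sin θ ^ 2) ^ 2 := by rw [← hsq]; ring
    rw [e1, hsq]
    ring
  have hc1 := continuous_legendreDelta k
  have hc3 : Continuous fun θ => 1 / legendreDelta k θ ^ 3 :=
    continuous_const.div (hc1.pow 3) fun θ => (pow_pos (legendreDelta_pos hk θ) 3).ne'
  have := intervalIntegral.integral_eq_sub_of_hasDerivAt (a := 0) (b := Real.pi / 2)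
    (fun θ _ => hd θ) ((hc1.sub (hc3.const_mul _)).intervalIntegrable _ _)
  rw [intervalIntegral.integral_sub (hc1.intervalIntegrable _ _)
    ((hc3.const_mul _).intervalIntegrable _ _), intervalIntegral.integral_const_mul] at this
  simp at this
  unfold ellipticE
  simp only [one_div] at this ⊢
  linarith

theorem pd1_one_div_legendreDelta {k : ℝ} (hk : k ∈ Ioo (-1 : ℝ) 1) (θ : ℝ) :
    pd1 (fun p : ℝ × ℝ => 1 / legendreDelta p.1 p.2) (k, θ)
      = k * Real.sin θ ^ 2 / legendreDelta k θ ^ 3 := by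
  have h1 := hasDerivAt_fst (differentiableAt_of_contDiffOn_strip (p := (k, θ)) isOpen_Ioo
    contDiffOn_one_div_legendreDelta hk)
  have hp := (legendreDelta_pos hk θ).ne'
  have h2 := (hasDerivAt_const k (1 : ℝ)).div (hasDerivAt_legendreDelta_modulus hk θ) hp
  rw [h1.unique h2]
  field_simp
  ring

theorem hasDerivAt_ellipticK {k : ℝ} (hk : k ∈ Ioo (0 : ℝ) 1) :
    HasDerivAt ellipticK ((ellipticE k / (1 - k ^ 2) - ellipticK k) / k) k := by
  have hk' : k ∈ Ioo (-1 : ℝ) 1 := ⟨by linarith [hk.1], hk.2⟩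
  have h := hasDerivAt_integral_fst isOpen_Ioo contDiffOn_one_div_legendreDelta hk' 0
    (Real.pi / 2)
  convert! h using 1
  have hc1 := continuous_one_div_legendreDelta hk'
  have hc3 : Continuous fun θ => 1 / legendreDelta k θ ^ 3 :=
    continuous_const.div ((continuous_legendreDelta k).pow 3)
      fun θ => (pow_pos (legendreDelta_pos hk' θ) 3).ne'
  have e : ∀ θ, pd1 (fun p : ℝ × ℝ => 1 / legendreDelta p.1 p.2) (k, θ)
      = (1 / k) * (1 / legendreDelta k θ ^ 3 - 1 / legendreDelta k θ) := fun θ => by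
    rw [pd1_one_div_legendreDelta hk']
    have hp := (legendreDelta_pos hk' θ).ne'
    have hk0 := hk.1.ne'
    have hsq := legendreDelta_sq hk' θ
    field_simp
    rw [hsq]; ring
  simp only [e]
  rw [intervalIntegral.integral_const_mul, intervalIntegral.integral_sub
    (hc3.intervalIntegrable _ _) (hc1.intervalIntegrable _ _)]
  have h3 := integral_one_div_legendreDelta_pow_three hk'
  have hpos : (1 - k ^ 2) ≠ 0 := by have := hk.1; have := hk.2; nlinarith
  rw [← h3, mul_div_cancel_left₀ _ hpos]
  change (_ - ∫ θ in (0 : ℝ)..(Real.pi / 2), 1 / legendreDelta k θ) / k = _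
  ring

theorem hasDerivAt_ellipticE {k : ℝ} (hk : k ∈ Ioo (0 : ℝ) 1) :
    HasDerivAt ellipticE ((ellipticE k - ellipticK k) / k) k := by
  have hk' : k ∈ Ioo (-1 : ℝ) 1 := ⟨by linarith [hk.1], hk.2⟩
  have h := hasDerivAt_integral_fst isOpen_Ioo contDiffOn_legendreDelta hk' 0 (Real.pi / 2)
  convert! h using 1
  have hc1 := continuous_one_div_legendreDelta hk'
  have e : ∀ θ, pd1 (fun p : ℝ × ℝ => legendreDelta p.1 p.2) (k, θ)
      = (1 / k) * (legendreDelta k θ - 1 / legendreDelta k θ) := fun θ => by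
    have h1 := hasDerivAt_fst (differentiableAt_of_contDiffOn_strip (p := (k, θ)) isOpen_Ioo
      contDiffOn_legendreDelta hk')
    rw [h1.unique (hasDerivAt_legendreDelta_modulus hk' θ)]
    have hp := (legendreDelta_pos hk' θ).ne'
    have hk0 := hk.1.ne'
    have hsq := legendreDelta_sq hk' θ
    field_simp
    rw [hsq]; ring
  simp only [e]
  rw [intervalIntegral.integral_const_mul, intervalIntegral.integral_sub
    ((continuous_legendreDelta k).intervalIntegrable _ _) (hc1.intervalIntegrable _ _)]
  change (_ - ∫ θ in (0 : ℝ)..(Real.pi / 2), 1 / legendreDelta k θ) / k = _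
  unfold ellipticE
  ring

/-- Pointwise Δ + p²/Δ³ ≥ 2p/Δ by the arithmetic-geometric inequality, and both terms on the left
integrate to E. -/
theorem mul_ellipticK_le_ellipticE {k p : ℝ} (hk : k ∈ Ioo (-1 : ℝ) 1)
    (hp : p ^ 2 = 1 - k ^ 2) : p * ellipticK k ≤ ellipticE k := by
  have hc1 := continuous_legendreDelta k
  have hc2 := continuous_one_div_legendreDelta hk
  have hc3 : Continuous fun θ => 1 / legendreDelta k θ ^ 3 :=
    continuous_const.div (hc1.pow 3) fun θ => (pow_pos (legendreDelta_pos hk θ) 3).ne'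
  have h0 : 0 ≤ ∫ θ in (0 : ℝ)..(Real.pi / 2), (legendreDelta k θ
      + (1 - k ^ 2) * (1 / legendreDelta k θ ^ 3) - 2 * p * (1 / legendreDelta k θ)) := by
    refine intervalIntegral.integral_nonneg (half_pos Real.pi_pos).le fun θ _ => ?_
    have hpos := legendreDelta_pos hk θ
    have : legendreDelta k θ + (1 - k ^ 2) * (1 / legendreDelta k θ ^ 3)
        - 2 * p * (1 / legendreDelta k θ)
        = (legendreDelta k θ ^ 2 - p) ^ 2 / legendreDelta k θ ^ 3 := by
      rw [← hp]; field_simp; ring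
    rw [this]; positivity
  have hi : IntervalIntegrable (fun θ => legendreDelta k θ
      + (1 - k ^ 2) * (1 / legendreDelta k θ ^ 3)) volume 0 (Real.pi / 2) :=
    (hc1.add (hc3.const_mul _)).intervalIntegrable _ _
  rw [intervalIntegral.integral_sub hi
      ((hc2.const_mul _).intervalIntegrable _ _),
    intervalIntegral.integral_add (hc1.intervalIntegrable _ _)
      ((hc3.const_mul _).intervalIntegrable _ _), intervalIntegral.integral_const_mul,
    intervalIntegral.integral_const_mul, integral_one_div_legendreDelta_pow_three hk] at h0
  change 0 ≤ ellipticE k + ellipticE k - 2 * p * ellipticK k at h0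
  linarith

theorem ellipticK_zero : ellipticK 0 = Real.pi / 2 := by
  simp [ellipticK, ellipticF]

/-- The complete integral of the first kind exceeds `-log k'`, `k'` the complementary modulus. -/
theorem neg_log_le_ellipticK {k p : ℝ} (hk : k ∈ Ioo (-1 : ℝ) 1) (hp0 : 0 < p)
    (hp : p ^ 2 = 1 - k ^ 2) : -Real.log p ≤ ellipticK k := by
  have hpos : ∀ θ ∈ Icc (0 : ℝ) (Real.pi / 2), 0 < Real.pi / 2 - θ + p := fun θ hθ => by
    linarith [hθ.2]
  have hu : uIcc 0 (Real.pi / 2) = Icc (0 : ℝ) (Real.pi / 2) :=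
    uIcc_of_le (half_pos Real.pi_pos).le
  have hci : ContinuousOn (fun θ => 1 / (Real.pi / 2 - θ + p)) (uIcc 0 (Real.pi / 2)) := by
    rw [hu]
    exact continuousOn_const.div (by fun_prop) fun θ hθ => (hpos θ hθ).ne'
  have hint := intervalIntegral.integral_eq_sub_of_hasDerivAt (a := 0) (b := Real.pi / 2)
    (f := fun θ => -Real.log (Real.pi / 2 - θ + p))
    (f' := fun θ => 1 / (Real.pi / 2 - θ + p)) (fun θ hθ => by
      rw [hu] at hθ
      have h := ((((hasDerivAt_id θ).const_sub (Real.pi / 2)).add_const p).log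
        (hpos θ hθ).ne').neg
      convert! h using 1
      simp only [id]; ring) hci.intervalIntegrable
  have hle : ∫ θ in (0 : ℝ)..(Real.pi / 2), 1 / (Real.pi / 2 - θ + p) ≤ ellipticK k := by
    refine intervalIntegral.integral_mono_on (half_pos Real.pi_pos).le hci.intervalIntegrable
      ((continuous_one_div_legendreDelta hk).intervalIntegrable _ _) fun θ hθ => ?_
    refine one_div_le_one_div_of_le (legendreDelta_pos hk θ) ?_
    -- Δ² = cos² θ + p² sin² θ ≤ (cos θ + p)², and cos θ ≤ π/2 - θ.
    refine Real.sqrt_le_iff.2 ⟨(hpos θ hθ).le, ?_⟩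
    have h1 : Real.cos θ ≤ Real.pi / 2 - θ := by
      rw [← Real.sin_pi_div_two_sub]; exact Real.sin_le (by linarith [hθ.2])
    have h2 : 0 ≤ Real.cos θ := Real.cos_nonneg_of_mem_Icc ⟨by linarith [hθ.1, Real.pi_pos], hθ.2⟩
    have h3 := Real.sin_sq_add_cos_sq θ
    nlinarith [mul_nonneg h2 hp0.le, sq_nonneg (Real.cos θ), mul_nonneg (sq_nonneg p)
      (sq_nonneg (Real.cos θ))]
  rw [hint] at hle
  simp only [sub_self, zero_add, sub_zero] at hle
  have hlog : 0 ≤ Real.log (Real.pi / 2 + p) :=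
    Real.log_nonneg (by linarith [Real.pi_gt_three])
  linarith

/-! ### The parameters of the normalized profile -/

/-- `√(k⁴ - k² + 1)`. -/
def modS (k : ℝ) : ℝ := Real.sqrt (k ^ 4 - k ^ 2 + 1)

/-- The integration constant of the normalized profile. -/
def normConst (k : ℝ) : ℝ :=
  25 / 864 * (2 - 3 * ((2 * k ^ 2 - 1) / modS k) + ((2 * k ^ 2 - 1) / modS k) ^ 3)

/-- The mean of the square of the normalized profile. -/
def meanSq (k : ℝ) : ℝ :=
  25 / (72 * modS k) * (modS k + k ^ 2 - 2 + 3 * (ellipticE k / ellipticK k))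

/-- Minus the logarithmic derivative of the period of the normalized profile with respect to the
integration constant. -/
def periodRate (k : ℝ) : ℝ :=
  (meanSq k - 6 * normConst k) / (36 * normConst k * (25 / 216 - normConst k))

/-- The derivative of `normConst`. -/
def normConstDeriv (k : ℝ) : ℝ := -(25 / 32) * k ^ 3 * (1 - k ^ 2) / modS k ^ 5

theorem modS_arg_pos (k : ℝ) : 0 < k ^ 4 - k ^ 2 + 1 := by nlinarith [sq_nonneg (k ^ 2 - 1 / 2)]

theorem modS_pos (k : ℝ) : 0 < modS k := Real.sqrt_pos.2 (modS_arg_pos k)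

theorem modS_sq (k : ℝ) : modS k ^ 2 = k ^ 4 - k ^ 2 + 1 := Real.sq_sqrt (modS_arg_pos k).le

theorem contDiff_modS : ContDiff ℝ ∞ modS := by
  have h : ContDiff ℝ ∞ (fun k : ℝ => k ^ 4 - k ^ 2 + 1) := by fun_prop
  exact h.sqrt fun k => (modS_arg_pos k).ne'

theorem hasDerivAt_modS (k : ℝ) : HasDerivAt modS (k * (2 * k ^ 2 - 1) / modS k) k := by
  have h : HasDerivAt (fun k : ℝ => k ^ 4 - k ^ 2 + 1) (4 * k ^ 3 - 2 * k) k := by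
    have := ((hasDerivAt_pow 4 k).sub (hasDerivAt_pow 2 k)).add_const 1
    convert! this using 1
    norm_num
  convert! h.sqrt (modS_arg_pos k).ne' using 1
  change _ = _ / (2 * modS k)
  have := (modS_pos k).ne'
  field_simp
  ring

theorem hasDerivAt_normConst (k : ℝ) : HasDerivAt normConst (normConstDeriv k) k := by
  have hx : HasDerivAt (fun k : ℝ => 2 * k ^ 2 - 1) (4 * k) k := by
    have := ((hasDerivAt_pow 2 k).const_mul 2).sub_const 1
    convert! this using 1
    norm_num; ring
  have hq := hx.div (hasDerivAt_modS k) (modS_pos k).ne'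
  have h := (((hq.const_mul 3).const_sub 2).add (hq.pow 3)).const_mul (25 / 864)
  convert! h using 1
  unfold normConstDeriv
  have hs := modS_sq k
  have hp := (modS_pos k).ne'
  simp only [Pi.div_apply, Nat.cast_ofNat, Nat.add_one_sub_one]
  set s := modS k
  field_simp
  have h4 : s ^ 4 = (k ^ 4 - k ^ 2 + 1) ^ 2 := by rw [← hs]; ring
  have h6 : s ^ 6 = (k ^ 4 - k ^ 2 + 1) ^ 3 := by rw [← hs]; ring
  ring_nf
  simp only [h4, hs]
  ring

/-- With q = (2k² - 1)/s the left side is (25/864)²(1 - q²)²(4 - q²), where 1 - q² = 3k²(1 - k²)/s²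
and 4 - q² = 3/s². -/
theorem normConst_mul_sub {k : ℝ} :
    normConst k * (25 / 216 - normConst k) =
      (25 / 864) ^ 2 * (27 * k ^ 4 * (1 - k ^ 2) ^ 2) / modS k ^ 6 := by
  unfold normConst
  have hs := modS_sq k
  have hp := (modS_pos k).ne'
  set s := modS k
  have h4 : s ^ 4 = (k ^ 4 - k ^ 2 + 1) ^ 2 := by rw [← hs]; ring
  have h6 : s ^ 6 = (k ^ 4 - k ^ 2 + 1) ^ 3 := by rw [← hs]; ring
  field_simp
  ring_nf
  simp only [h6, h4, hs]
  ring

theorem abs_ratio_lt_one {k : ℝ} (hk : k ∈ Ioo (0 : ℝ) 1) :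
    |(2 * k ^ 2 - 1) / modS k| < 1 := by
  rw [abs_div, abs_of_pos (modS_pos k), div_lt_one (modS_pos k)]
  refine abs_lt_of_sq_lt_sq ?_ (modS_pos k).le
  rw [modS_sq]
  have h2 : 0 < k ^ 2 := pow_pos hk.1 2
  have h3 : k ^ 2 < 1 := by have := hk.1; have := hk.2; nlinarith
  nlinarith [mul_pos h2 (sub_pos.2 h3)]

/-- 2 - 3q + q³ = (1 - q)²(2 + q) and 2 + 3q - q³ = (1 + q)²(2 - q) with |q| < 1. The endpoint 0 is
the level of the solitary wave, 25/216 that of the constant solution 5/6. -/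
theorem normConst_mem {k : ℝ} (hk : k ∈ Ioo (0 : ℝ) 1) : normConst k ∈ Ioo (0 : ℝ) (25 / 216) := by
  obtain ⟨h1, h2⟩ := abs_lt.1 (abs_ratio_lt_one hk)
  unfold normConst
  set q := (2 * k ^ 2 - 1) / modS k
  constructor
  · nlinarith [mul_pos (pow_pos (sub_pos.2 h2) 2) (show 0 < 2 + q by linarith)]
  · nlinarith [mul_pos (pow_pos (show 0 < 1 + q by linarith) 2) (show 0 < 2 - q by linarith)]

theorem periodRate_mul_normConstDeriv {k : ℝ} (hk : k ∈ Ioo (0 : ℝ) 1) :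
    periodRate k * normConstDeriv k =
      -(24 / 25) * (modS k * (meanSq k - 6 * normConst k)) / (k * (1 - k ^ 2)) := by
  unfold periodRate normConstDeriv
  have hk0 := hk.1.ne'
  have hk1 : (1 - k ^ 2) ≠ 0 := by have := hk.1; have := hk.2; nlinarith
  have hp := (modS_pos k).ne'
  rw [mul_assoc 36, normConst_mul_sub]
  field_simp
  ring

theorem modS_mul_excess (k : ℝ) :
    modS k * (meanSq k - 6 * normConst k) = 25 / 216 * (12 * k ^ 2 - 21 / 2
      + 9 * (ellipticE k / ellipticK k) - 3 * (2 * k ^ 2 - 1) ^ 3 / (2 * (k ^ 4 - k ^ 2 + 1))) := by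
  unfold meanSq normConst
  rw [← modS_sq k]
  have hp := (modS_pos k).ne'
  field_simp
  ring

/-- P is the square of the period of the profile in the variable where P/L² is scaled to 1, so P'/P
is twice the logarithmic derivative of that period, taken through `normConst`. -/
theorem hasDerivAt_thresholdFun {k : ℝ} (hk : k ∈ Ioo (0 : ℝ) 1) :
    HasDerivAt thresholdFun (-2 * thresholdFun k * (periodRate k * normConstDeriv k)) k := by
  have h := ((((hasDerivAt_ellipticK hk).pow 2).const_mul 64).mul (hasDerivAt_modS k))
  convert! h using 1
  rw [periodRate_mul_normConstDeriv hk, modS_mul_excess]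
  change -2 * (64 * ellipticK k ^ 2 * modS k) * _ = _
  have hs := modS_sq k
  have hp := (modS_pos k).ne'
  have hk0 := hk.1.ne'
  have hk1 : (1 - k ^ 2) ≠ 0 := by have := hk.1; have := hk.2; nlinarith
  have hK := (ellipticK_pos ⟨by linarith [hk.1], hk.2⟩ : 0 < ellipticK k).ne'
  have hS := (modS_arg_pos k).ne'
  rw [← hs]
  simp only [Nat.cast_ofNat, Nat.add_one_sub_one, pow_one, Pi.pow_apply]
  set s := modS k
  field_simp
  ring_nf
  simp only [hs]
  ring

/-- In other words dv/da = 1 + l(v - 6a): no elliptic integral other than those inside v appears,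
which closes the system for y, a, v. -/
theorem hasDerivAt_meanSq {k : ℝ} (hk : k ∈ Ioo (0 : ℝ) 1) :
    HasDerivAt meanSq
      (normConstDeriv k + periodRate k * normConstDeriv k * (meanSq k - 6 * normConst k)) k := by
  have hp := (modS_pos k).ne'
  have hK := (ellipticK_pos ⟨by linarith [hk.1], hk.2⟩ : 0 < ellipticK k).ne'
  have h1 := ((hasDerivAt_modS k).add (hasDerivAt_pow 2 k)).sub_const 2
  have h2 := ((hasDerivAt_ellipticE hk).div (hasDerivAt_ellipticK hk) hK).const_mul 3
  have h := ((hasDerivAt_const k (25 : ℝ)).div ((hasDerivAt_modS k).const_mul 72)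
    (mul_ne_zero (by norm_num) hp)).mul (h1.add h2)
  convert! h using 1
  rw [periodRate_mul_normConstDeriv hk]
  have e1 : meanSq k - 6 * normConst k = (modS k * (meanSq k - 6 * normConst k)) / modS k := by
    field_simp
  rw [e1, mul_div_cancel₀ _ hp, modS_mul_excess]
  unfold normConstDeriv
  have hs := modS_sq k
  have hk0 := hk.1.ne'
  have hk1 : (1 - k ^ 2) ≠ 0 := by have := hk.1; have := hk.2; nlinarith
  have hS := (modS_arg_pos k).ne'
  simp only [Nat.cast_ofNat, Nat.add_one_sub_one, pow_one, Pi.add_apply,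
    Pi.div_apply]
  set s := modS k
  have h5 : s ^ 5 = s * (k ^ 4 - k ^ 2 + 1) ^ 2 := by rw [← hs]; ring
  rw [h5]
  generalize hSd : k ^ 4 - k ^ 2 + 1 = S at *
  field_simp
  rw [hs]
  subst hSd
  linear_combination (-(32 * (k ^ 4 - k ^ 2 + 1) ^ 2 * 216 ^ 2 * 2 ^ 2 * 25 *
    (2 * k ^ 2 * (1 - k ^ 2) * ellipticK k ^ 2 + 3 * ((1 - k ^ 2) * ellipticK k *
      (ellipticE k - ellipticK k) - ellipticE k * (ellipticE k - (1 - k ^ 2) * ellipticK k))))) * hs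

theorem three_mul_le_excess {k p : ℝ} (hk : k ∈ Ioo (0 : ℝ) 1) (hp0 : 0 < p)
    (hp : p ^ 2 = 1 - k ^ 2) :
    3 * p * (25 / 216 - normConst k) ≤ meanSq k - 6 * normConst k := by
  have hk' : k ∈ Ioo (-1 : ℝ) 1 := ⟨by linarith [hk.1], hk.2⟩
  have ht : p ≤ ellipticE k / ellipticK k :=
    (le_div_iff₀ (ellipticK_pos hk')).2 (mul_ellipticK_le_ellipticE hk' hp)
  unfold meanSq normConst
  have hs := modS_sq k
  have hs0 := modS_pos k
  set s := modS k
  set t := ellipticE k / ellipticK k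
  have hk2 : k ^ 2 = 1 - p ^ 2 := by linarith
  have hp1 : p < 1 := by nlinarith [pow_pos hk.1 2]
  have hS : s ^ 2 = p ^ 4 - p ^ 2 + 1 := by
    rw [hs, show k ^ 4 = (k ^ 2) ^ 2 by ring, hk2]; ring
  have hs1 : s ≤ (1 + (p ^ 4 - p ^ 2 + 1)) / 2 := by nlinarith [sq_nonneg (s - 1)]
  have hSp : 0 < p ^ 4 - p ^ 2 + 1 := hS ▸ pow_pos hs0 2
  -- This is exactly right side minus left side of `key` after s² is replaced by p⁴ - p² + 1 and the
  -- remaining factor s, whose coefficient is negative, by its upper bound (1 + s²)/2.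
  have hT : 0 ≤ (1 - p) ^ 2 * (p * (4 + 5 * p + 3 * p ^ 2 - 2 * p ^ 3 - 3 / 2 * p ^ 4 - p ^ 5
      - 1 / 2 * p ^ 6)) := by
    have h3 : p ^ 3 ≤ 1 := pow_le_one₀ hp0.le hp1.le
    have h4 : p ^ 4 ≤ 1 := pow_le_one₀ hp0.le hp1.le
    have h5 : p ^ 5 ≤ 1 := pow_le_one₀ hp0.le hp1.le
    have h6 : p ^ 6 ≤ 1 := pow_le_one₀ hp0.le hp1.le
    have h7 : p ^ 3 ≤ p ^ 2 := pow_le_pow_of_le_one hp0.le hp1.le (by norm_num)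
    have h8 : p ^ 4 ≤ p ^ 2 := pow_le_pow_of_le_one hp0.le hp1.le (by norm_num)
    refine mul_nonneg (sq_nonneg _) (mul_nonneg hp0.le ?_)
    nlinarith [sq_nonneg p]
  have key : 2 * s ^ 2 * (s + 1 + p ^ 2 - 3 * p)
      ≤ (2 * s ^ 3 + 3 * s ^ 2 * (1 - 2 * p ^ 2) - (1 - 2 * p ^ 2) ^ 3) * (1 - p / 2) := by
    have e3 : s ^ 3 = s * (p ^ 4 - p ^ 2 + 1) := by rw [← hS]; ring
    rw [e3, hS]
    nlinarith [mul_le_mul_of_nonneg_left hs1 (mul_pos hp0 hSp).le]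
  rw [hk2]
  have e : 25 / (72 * s) * (s + (1 - p ^ 2) - 2 + 3 * t)
      - 6 * (25 / 864 * (2 - 3 * ((2 * (1 - p ^ 2) - 1) / s) + ((2 * (1 - p ^ 2) - 1) / s) ^ 3))
      - 3 * p * (25 / 216 - 25 / 864 * (2 - 3 * ((2 * (1 - p ^ 2) - 1) / s)
        + ((2 * (1 - p ^ 2) - 1) / s) ^ 3))
      = 25 / (144 * s ^ 3) * (((2 * s ^ 3 + 3 * s ^ 2 * (1 - 2 * p ^ 2) - (1 - 2 * p ^ 2) ^ 3)
        * (1 - p / 2) - 2 * s ^ 2 * (s + 1 + p ^ 2 - 3 * p)) + 6 * s ^ 2 * (t - p)) := by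
    field_simp
    ring
  rw [← sub_nonneg, e]
  have := mul_nonneg (mul_nonneg (by norm_num : (0 : ℝ) ≤ 6) (sq_nonneg s)) (sub_nonneg.2 ht)
  have hc : 0 < 25 / (144 * s ^ 3) := by positivity
  exact mul_nonneg hc.le (by linarith)

theorem normConst_le {k p : ℝ} (hk : k ∈ Ioo (0 : ℝ) 1) (hp0 : 0 < p)
    (hp : p ^ 2 = 1 - k ^ 2) : normConst k ≤ 25 / 108 * p ^ 2 := by
  unfold normConst
  have hs := modS_sq k
  have hs0 := modS_pos k
  set s := modS k
  have hk2 : k ^ 2 = 1 - p ^ 2 := by linarith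
  have hu1 : p ^ 2 < 1 := by nlinarith [pow_pos hk.1 2]
  have hu0 : 0 < p ^ 2 := pow_pos hp0 2
  have hS : s ^ 2 = (p ^ 2) ^ 2 - p ^ 2 + 1 := by
    rw [hs, show k ^ 4 = (k ^ 2) ^ 2 by ring, hk2]; ring
  rw [hk2]
  generalize p ^ 2 = u at *
  have hs1 : s ≤ 1 := by nlinarith
  have hs2 : (1 + u) / 2 ≤ s := by
    refine abs_le_of_sq_le_sq' ?_ hs0.le |>.2
    nlinarith [sq_nonneg (u - 1)]
  have e3 : s ^ 3 = s * (u ^ 2 - u + 1) := by rw [← hS]; ring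
  have hSp : 0 < u ^ 2 - u + 1 := hS ▸ pow_pos hs0 2
  have key : 2 * s ^ 3 * (1 - 4 * u) ≤ 3 * s ^ 2 * (1 - 2 * u) - (1 - 2 * u) ^ 3 := by
    rw [e3, hS]
    -- The remaining factor s occurs with coefficient proportional to 1 - 4u, so its sign decides
    -- which bound on s applies.
    rcases le_total (1 - 4 * u) 0 with h | h
    · nlinarith [mul_le_mul_of_nonpos_right hs2 (mul_nonpos_of_nonneg_of_nonpos hSp.le h),
        mul_pos hu0 (sub_pos.2 hu1), mul_pos (mul_pos hu0 hu0) (sub_pos.2 hu1)]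
    · nlinarith [mul_le_mul_of_nonneg_right hs1 (mul_nonneg hSp.le h),
        mul_pos hu0 (sub_pos.2 hu1), mul_pos (mul_pos hu0 hu0) (sub_pos.2 hu1)]
  have e : 25 / 108 * u - 25 / 864 * (2 - 3 * ((2 * (1 - u) - 1) / s) + ((2 * (1 - u) - 1) / s) ^ 3)
      = 25 / (864 * s ^ 3) * (3 * s ^ 2 * (1 - 2 * u) - (1 - 2 * u) ^ 3
        - 2 * s ^ 3 * (1 - 4 * u)) := by
    field_simp
    ring
  rw [← sub_nonneg, e]
  have hc : 0 < 25 / (864 * s ^ 3) := by positivity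
  exact mul_nonneg hc.le (by linarith)

theorem exists_complementary_modulus {k : ℝ} (hk : k ∈ Ioo (0 : ℝ) 1) :
    ∃ p : ℝ, 0 < p ∧ p ^ 2 = 1 - k ^ 2 := by
  have h : 0 < 1 - k ^ 2 := by have := hk.1; have := hk.2; nlinarith
  exact ⟨_, Real.sqrt_pos.2 h, Real.sq_sqrt h.le⟩

/-- Eliminates p: square the bound 3p(25/216 - a) ≤ v - 6a and insert p² ≥ (108/25)a; 972/25 = 9 ·
108/25. -/
theorem excess_bounds {k : ℝ} (hk : k ∈ Ioo (0 : ℝ) 1) :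
    0 < meanSq k - 6 * normConst k ∧
      972 / 25 * (25 / 216 - normConst k) ^ 2 * normConst k
        ≤ (meanSq k - 6 * normConst k) ^ 2 := by
  obtain ⟨p, hp0, hp⟩ := exists_complementary_modulus hk
  have h1 := three_mul_le_excess hk hp0 hp
  have h2 := normConst_le hk hp0 hp
  have h3 := normConst_mem hk
  have h4 : 0 < 25 / 216 - normConst k := sub_pos.2 h3.2
  have h5 : 0 < 3 * p * (25 / 216 - normConst k) := by positivity
  refine ⟨h5.trans_le h1, le_trans ?_ (pow_le_pow_left₀ h5.le h1 2)⟩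
  nlinarith [mul_le_mul_of_nonneg_left h2 (pow_pos h4 2).le]

theorem periodRate_pos {k : ℝ} (hk : k ∈ Ioo (0 : ℝ) 1) : 0 < periodRate k := by
  have h := normConst_mem hk
  have h1 := sub_pos.2 h.2
  have h2 := h.1
  exact div_pos (excess_bounds hk).1 (by positivity)

theorem normConstDeriv_neg {k : ℝ} (hk : k ∈ Ioo (0 : ℝ) 1) : normConstDeriv k < 0 := by
  have h1 : 0 < 1 - k ^ 2 := by have := hk.1; have := hk.2; nlinarith
  have h2 := hk.1
  have h3 := modS_pos k
  have : 0 < 25 / 32 * k ^ 3 * (1 - k ^ 2) / modS k ^ 5 := by positivity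
  unfold normConstDeriv
  have e : -(25 / 32) * k ^ 3 * (1 - k ^ 2) / modS k ^ 5
    = -(25 / 32 * k ^ 3 * (1 - k ^ 2) / modS k ^ 5) := by ring
  rw [e]; linarith

/-! ### The threshold modulus -/

theorem strictMonoOn_thresholdFun : StrictMonoOn thresholdFun (Ioo (0 : ℝ) 1) := by
  refine strictMonoOn_of_deriv_pos (convex_Ioo 0 1)
    (fun k hk => (hasDerivAt_thresholdFun hk).continuousAt.continuousWithinAt) fun k hk => ?_
  rw [interior_Ioo] at hk
  rw [(hasDerivAt_thresholdFun hk).deriv]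
  have h1 := mul_neg_of_pos_of_neg (periodRate_pos hk) (normConstDeriv_neg hk)
  have h2 : 0 < thresholdFun k := by
    have := ellipticK_pos (k := k) ⟨by linarith [hk.1], hk.2⟩
    have := modS_pos k
    change 0 < 64 * ellipticK k ^ 2 * modS k
    positivity
  nlinarith

/-- The interval extends below 0 because the intermediate value argument starts at k = 0. -/
theorem continuousOn_thresholdFun : ContinuousOn thresholdFun (Ioo (-1 : ℝ) 1) :=
  (continuousOn_const.mul (contDiffOn_ellipticK.continuousOn.pow 2)).mul
    contDiff_modS.continuous.continuousOn

theorem exists_thresholdFun_gt (L : ℝ) (hL : 0 < L) : ∃ k ∈ Ioo (0 : ℝ) 1, L ^ 2 < thresholdFun k := by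
  -- With this complementary modulus the logarithmic bound gives K ≥ L, and s ≥ 1/2 then gives P ≥
  -- 32L².
  set p := Real.exp (-L) with hp
  have hp0 : 0 < p := Real.exp_pos _
  have hp1 : p < 1 := by rw [hp, Real.exp_lt_one_iff]; linarith
  have h1 : 0 < 1 - p ^ 2 := by nlinarith
  have hk2 : Real.sqrt (1 - p ^ 2) ^ 2 = 1 - p ^ 2 := Real.sq_sqrt h1.le
  have hk0 : 0 < Real.sqrt (1 - p ^ 2) := Real.sqrt_pos.2 h1
  set k := Real.sqrt (1 - p ^ 2)
  have hk : k ∈ Ioo (0 : ℝ) 1 := ⟨hk0, by nlinarith [pow_pos hp0 2]⟩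
  have hK := neg_log_le_ellipticK (k := k) ⟨by linarith, hk.2⟩ hp0 (by linarith)
  rw [hp, Real.log_exp, neg_neg] at hK
  refine ⟨k, hk, ?_⟩
  change _ < 64 * ellipticK k ^ 2 * modS k
  have hs : 1 / 2 ≤ modS k := by
    refine Real.le_sqrt_of_sq_le ?_
    nlinarith [sq_nonneg (k ^ 2 - 1 / 2)]
  have hK2 : L ^ 2 ≤ ellipticK k ^ 2 := pow_le_pow_left₀ hL.le hK 2
  nlinarith [pow_pos hL 2]

theorem exists_threshold_modulus {L : ℝ} (hL : 4 * Real.pi < L) :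
    ∃ kL ∈ Ioo (0 : ℝ) 1, thresholdFun kL = L ^ 2 := by
  have hL0 : 0 < L := by linarith [Real.pi_pos]
  obtain ⟨k₁, hk₁, h1⟩ := exists_thresholdFun_gt L hL0
  have h0 : thresholdFun 0 < L ^ 2 := by
    simp only [thresholdFun, ellipticK_zero]
    norm_num
    nlinarith [Real.pi_pos]
  obtain ⟨k, hk, hkL⟩ := intermediate_value_Ioo hk₁.1.le
    (continuousOn_thresholdFun.mono fun x hx => ⟨by linarith [hx.1], by linarith [hx.2, hk₁.2]⟩)
    (show L ^ 2 ∈ Ioo (thresholdFun 0) (thresholdFun k₁) from ⟨h0, h1⟩)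
  exact ⟨k, ⟨hk.1, hk.2.trans hk₁.2⟩, hkL⟩

/-! ### Scaling -/

/-- The amplitude factor `P / (L² - P)`, `P` the threshold function. -/
def ampl (L k : ℝ) : ℝ := thresholdFun k / mTilde L k

/-- The moduli on which the wave is defined. -/
def admissible (L : ℝ) : Set ℝ := {k | k ∈ Ioo (0 : ℝ) 1 ∧ 0 < mTilde L k}

theorem mTilde_eq (L k : ℝ) : mTilde L k = L ^ 2 - thresholdFun k := rfl

theorem thresholdFun_eq (k : ℝ) : thresholdFun k = 64 * ellipticK k ^ 2 * modS k := rfl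

theorem isOpen_admissible (L : ℝ) : IsOpen (admissible L) := by
  have h : ContinuousOn (mTilde L) (Ioo (0 : ℝ) 1) :=
    continuousOn_const.sub (continuousOn_thresholdFun.mono
      (Ioo_subset_Ioo_left (by norm_num)))
  exact h.isOpen_inter_preimage isOpen_Ioo isOpen_Ioi

section Admissible

variable {L k : ℝ}

theorem thresholdFun_pos (hk : k ∈ Ioo (0 : ℝ) 1) : 0 < thresholdFun k := by
  have := ellipticK_pos (k := k) ⟨by linarith [hk.1], hk.2⟩
  have := modS_pos k
  rw [thresholdFun_eq]
  positivity

theorem ampl_pos (hk : k ∈ admissible L) : 0 < ampl L k := div_pos (thresholdFun_pos hk.1) hk.2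

theorem waveSpeed_eq (hk : k ∈ admissible L) : waveSpeed L k = 1 + ampl L k := by
  have := hk.2.ne'
  unfold waveSpeed ampl
  field_simp
  rw [mTilde_eq]; ring

theorem ampl_eq_mul (hL : L ≠ 0) (hk : k ∈ admissible L) :
    ampl L k = (1 + ampl L k) * (thresholdFun k / L ^ 2) := by
  have := hk.2.ne'
  unfold ampl
  field_simp
  rw [mTilde_eq]; ring

theorem intConst_eq (hk : k ∈ admissible L) :
    intConst L k = -(ampl L k ^ 3 * normConst k) := by
  have h1 := hk.2.ne'
  have h2 := (modS_pos k).ne'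
  unfold intConst ampl normConst
  rw [thresholdFun_eq]
  change -204800 * ellipticK k ^ 6 / (27 * mTilde L k ^ 3) * ((modS k - (2 * k ^ 2 - 1)) ^ 2 *
    (2 * modS k + (2 * k ^ 2 - 1))) = _
  field_simp
  ring

theorem hasDerivAt_ampl (hk : k ∈ admissible L) :
    HasDerivAt (ampl L)
      (-2 * (periodRate k * normConstDeriv k) * (ampl L k * (1 + ampl L k))) k := by
  have hP := hasDerivAt_thresholdFun hk.1
  have h := hP.div (hP.const_sub (L ^ 2)) (show L ^ 2 - thresholdFun k ≠ 0 from hk.2.ne')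
  convert! h using 1
  have := hk.2.ne'
  unfold ampl
  rw [← mTilde_eq]
  field_simp
  rw [mTilde_eq]; ring

theorem hasDerivAt_waveSpeed (hk : k ∈ admissible L) :
    HasDerivAt (waveSpeed L)
      (-2 * (periodRate k * normConstDeriv k) * (ampl L k * (1 + ampl L k))) k := by
  refine ((hasDerivAt_ampl hk).const_add 1).congr_of_eventuallyEq ?_
  filter_upwards [(isOpen_admissible L).mem_nhds hk] with κ hκ using waveSpeed_eq hκ

theorem hasDerivAt_intConst (hk : k ∈ admissible L) :
    HasDerivAt (intConst L)
      (-(3 * ampl L k ^ 2 * (-2 * (periodRate k * normConstDeriv k) *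
        (ampl L k * (1 + ampl L k))) * normConst k + ampl L k ^ 3 * normConstDeriv k)) k := by
  have h := (((hasDerivAt_ampl hk).pow 3).mul (hasDerivAt_normConst k)).neg
  have h' : HasDerivAt (intConst L) _ k := h.congr_of_eventuallyEq (by
    filter_upwards [(isOpen_admissible L).mem_nhds hk] with κ hκ using intConst_eq hκ)
  convert! h' using 1

/-! ### The normalized profile -/

/-- The amplitude along the wave. -/
def phase (L k x : ℝ) : ℝ := jacobiAm k (2 * ellipticK k / L * x)

/-- The normalized profile. -/
def profile (L k x : ℝ) : ℝ :=
  5 / (12 * modS k) * (modS k + 1 - 2 * k ^ 2 + 3 * k ^ 2 * Real.cos (phase L k x) ^ 2)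

/-- The `x`-derivative of the normalized profile. -/
def profileDx (L k x : ℝ) : ℝ :=
  -(5 * k ^ 2 / (2 * modS k)) * (2 * ellipticK k / L) *
    (Real.sin (phase L k x) * Real.cos (phase L k x) * legendreDelta k (phase L k x))

/-- The square root of the wave. -/
def waveRoot (L k x : ℝ) : ℝ := ampl L k * profile L k x

theorem wave_eq (hk : k ∈ admissible L) (x : ℝ) : wave L k x = waveRoot L k x ^ 2 := by
  have h1 := hk.2.ne'
  have h2 := (modS_pos k).ne'
  have h3 : L ^ 2 = mTilde L k + 64 * ellipticK k ^ 2 * modS k := by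
    rw [mTilde_eq, thresholdFun_eq]; ring
  unfold wave waveRoot ampl profile jacobiCN phase
  rw [thresholdFun_eq, h3]
  congr 1
  field_simp
  ring

theorem mem_Ioo_neg_one_one (hk : k ∈ Ioo (0 : ℝ) 1) : k ∈ Ioo (-1 : ℝ) 1 :=
  ⟨by linarith [hk.1], hk.2⟩

theorem profile_pos (hk : k ∈ Ioo (0 : ℝ) 1) (x : ℝ) : 0 < profile L k x := by
  have hs := modS_pos k
  have h := (abs_lt.1 (abs_ratio_lt_one hk)).2
  rw [div_lt_one hs] at h
  have : 0 < modS k + 1 - 2 * k ^ 2 + 3 * k ^ 2 * Real.cos (phase L k x) ^ 2 := by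
    nlinarith [mul_nonneg (sq_nonneg k) (sq_nonneg (Real.cos (phase L k x)))]
  unfold profile
  positivity

theorem waveRoot_pos (hk : k ∈ admissible L) (x : ℝ) : 0 < waveRoot L k x :=
  mul_pos (ampl_pos hk) (profile_pos hk.1 x)

theorem sqrt_wave (hk : k ∈ admissible L) (x : ℝ) : Real.sqrt (wave L k x) = waveRoot L k x := by
  rw [wave_eq hk, Real.sqrt_sq (waveRoot_pos hk x).le]

theorem phase_zero (hk : k ∈ Ioo (0 : ℝ) 1) : phase L k 0 = 0 := by
  rw [phase, mul_zero, jacobiAm_zero (mem_Ioo_neg_one_one hk)]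

theorem phase_add (hL : L ≠ 0) (hk : k ∈ Ioo (0 : ℝ) 1) (x : ℝ) :
    phase L k (x + L) = phase L k x + Real.pi := by
  rw [phase, phase, ← jacobiAm_add (mem_Ioo_neg_one_one hk)]
  congr 1
  field_simp

theorem hasDerivAt_phase (hk : k ∈ Ioo (0 : ℝ) 1) (x : ℝ) :
    HasDerivAt (phase L k) (legendreDelta k (phase L k x) * (2 * ellipticK k / L)) x := by
  have h := hasDerivAt_jacobiAm (mem_Ioo_neg_one_one hk) (2 * ellipticK k / L * x)
  have h2 := (hasDerivAt_id x).const_mul (2 * ellipticK k / L)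
  rw [mul_one] at h2
  exact h.comp x h2

theorem profile_periodic (hL : L ≠ 0) (hk : k ∈ Ioo (0 : ℝ) 1) :
    Function.Periodic (profile L k) L := fun x => by
  simp [profile, phase_add hL hk]

theorem profileDx_periodic (hL : L ≠ 0) (hk : k ∈ Ioo (0 : ℝ) 1) :
    Function.Periodic (profileDx L k) L := fun x => by
  simp [profileDx, phase_add hL hk, legendreDelta_periodic k _]

theorem hasDerivAt_profile (hk : k ∈ Ioo (0 : ℝ) 1) (x : ℝ) :
    HasDerivAt (profile L k) (profileDx L k x) x := by
  have h := (((((hasDerivAt_phase (L := L) hk x).cos).pow 2).const_mul (3 * k ^ 2)).const_add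
    (modS k + 1 - 2 * k ^ 2)).const_mul (5 / (12 * modS k))
  convert! h using 1
  unfold profileDx
  have := (modS_pos k).ne'
  field_simp
  norm_num
  ring

theorem hasDerivAt_profileDx (hk : k ∈ Ioo (0 : ℝ) 1) (x : ℝ) :
    HasDerivAt (profileDx L k)
      (thresholdFun k / L ^ 2 * (profile L k x / 4 - 3 / 10 * profile L k x ^ 2)) x := by
  have hk' := mem_Ioo_neg_one_one hk
  have hp := hasDerivAt_phase (L := L) hk x
  have hD := (hasDerivAt_legendreDelta hk' (phase L k x)).comp x hp
  have h := ((hp.sin.mul hp.cos).mul hD).const_mul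
    (-(5 * k ^ 2 / (2 * modS k)) * (2 * ellipticK k / L))
  convert! h using 1
  rw [thresholdFun_eq]
  unfold profile
  have hs := (modS_pos k).ne'
  have hss := modS_sq k
  have hsq := legendreDelta_sq hk' (phase L k x)
  have hd := (legendreDelta_pos hk' (phase L k x)).ne'
  have hcs := Real.sin_sq (phase L k x)
  simp only [Function.comp, Pi.mul_apply]
  set D := legendreDelta k (phase L k x)
  set S := Real.sin (phase L k x)
  set C := Real.cos (phase L k x)
  set s := modS k
  have e : ((C * (D * (2 * ellipticK k / L)) * C + S * (-S * (D * (2 * ellipticK k / L)))) * D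
      + S * C * (-(k ^ 2 * S * C) / D * (D * (2 * ellipticK k / L))))
      = (2 * ellipticK k / L) * ((C ^ 2 - S ^ 2) * D ^ 2 - k ^ 2 * S ^ 2 * C ^ 2) := by
    field_simp
    ring
  rw [e, hsq, hcs]
  have e2 : ∀ w : ℝ, 5 / (12 * s) * w / 4 - 3 / 10 * (5 / (12 * s) * w) ^ 2
      = 5 / (96 * s ^ 2) * (s ^ 2 - (w - s) ^ 2) := fun w => by
    field_simp
    ring
  rw [e2]
  have e3 : s ^ 2 - (s + 1 - 2 * k ^ 2 + 3 * k ^ 2 * C ^ 2 - s) ^ 2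
      = -3 * k ^ 2 * ((C ^ 2 - (1 - C ^ 2)) * (1 - k ^ 2 * (1 - C ^ 2))
        - k ^ 2 * (1 - C ^ 2) * C ^ 2) := by
    rw [hss]; ring
  rw [e3]
  -- Here division by zero is zero, so both sides vanish.
  by_cases hL : L = 0
  · simp [hL]
  field_simp
  ring

theorem profileDx_sq (hk : k ∈ Ioo (0 : ℝ) 1) (x : ℝ) :
    profileDx L k x ^ 2 = thresholdFun k / L ^ 2 *
      (profile L k x ^ 2 / 4 - profile L k x ^ 3 / 5 - normConst k / 2) := by
  have hk' := mem_Ioo_neg_one_one hk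
  rw [thresholdFun_eq]
  unfold profile profileDx normConst
  have hs := (modS_pos k).ne'
  have hss := modS_sq k
  have hsq := legendreDelta_sq hk' (phase L k x)
  have hcs := Real.sin_sq (phase L k x)
  set D := legendreDelta k (phase L k x)
  set S := Real.sin (phase L k x)
  set C := Real.cos (phase L k x)
  set s := modS k
  rw [mul_pow, mul_pow, mul_pow, mul_pow, hsq, hcs]
  -- For x = 2k² - 1 the cubic vanishes at w - s = -x, and w - s + x = 3k² cos² of the phase; this
  -- produces the factor cos².
  have e : ∀ w x : ℝ, (5 / (12 * s) * w) ^ 2 / 4 - (5 / (12 * s) * w) ^ 3 / 5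
        - 25 / 864 * (2 - 3 * (x / s) + (x / s) ^ 3) / 2
      = 25 / (1728 * s ^ 3) * (3 * s ^ 2 * (w - s + x) - ((w - s) ^ 3 + x ^ 3)) := fun w x => by
    field_simp
    ring
  rw [e, hss]
  by_cases hL : L = 0
  · simp [hL]
  field_simp
  ring

end Admissible

/-! ### Moments of the profile -/

section Moments

variable {L k : ℝ}

theorem continuous_profile (hk : k ∈ Ioo (0 : ℝ) 1) : Continuous (profile L k) :=
  continuous_iff_continuousAt.2 fun x => (hasDerivAt_profile hk x).continuousAt

/-- The moments of the profile over a period. -/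
def moment (L k : ℝ) (n : ℕ) : ℝ := ∫ x in (0 : ℝ)..L, profile L k x ^ n

theorem moment_zero : moment L k 0 = L := by simp [moment]

theorem integral_profile_combination (hk : k ∈ Ioo (0 : ℝ) 1) (a b c : ℝ) (i j l : ℕ) :
    ∫ x in (0 : ℝ)..L, (a * profile L k x ^ i + b * profile L k x ^ j + c * profile L k x ^ l)
      = a * moment L k i + b * moment L k j + c * moment L k l := by
  have h : ∀ (a : ℝ) (i : ℕ), IntervalIntegrable (fun x => a * profile L k x ^ i) volume 0 L :=
    fun a i => (((continuous_profile hk).pow i).const_mul a).intervalIntegrable _ _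
  rw [intervalIntegral.integral_add ((h a i).add (h b j)) (h c l),
    intervalIntegral.integral_add (h a i) (h b j)]
  simp only [intervalIntegral.integral_const_mul]
  rfl

/-- Substitution θ = `phase L k x`, dθ = (2K/L) Δ dx; one period covers [0, π]. -/
theorem integral_legendreDelta_phase_sq (hL : L ≠ 0) (hk : k ∈ Ioo (0 : ℝ) 1) :
    ∫ x in (0 : ℝ)..L, legendreDelta k (phase L k x) ^ 2
      = L * (ellipticE k / ellipticK k) := by
  have hk' := mem_Ioo_neg_one_one hk
  have hK := (ellipticK_pos hk').ne'
  have hc := continuous_legendreDelta k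
  have hphase : Continuous (phase L k) :=
    continuous_iff_continuousAt.2 fun x => (hasDerivAt_phase hk x).continuousAt
  have hF : ∀ φ, HasDerivAt (fun φ => ∫ θ in (0 : ℝ)..φ, legendreDelta k θ)
      (legendreDelta k φ) φ := fun φ =>
    intervalIntegral.integral_hasDerivAt_right (hc.intervalIntegrable 0 φ)
      (hc.stronglyMeasurableAtFilter _ _) hc.continuousAt
  have hd : ∀ x, HasDerivAt
      (fun x => L / (2 * ellipticK k) * ∫ θ in (0 : ℝ)..phase L k x, legendreDelta k θ)
      (legendreDelta k (phase L k x) ^ 2) x := fun x => by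
    have h := ((hF (phase L k x)).comp x (hasDerivAt_phase hk x)).const_mul (L / (2 * ellipticK k))
    convert! h using 1
    field_simp
  rw [intervalIntegral.integral_eq_sub_of_hasDerivAt (fun x _ => hd x)
    (((hc.comp hphase).pow 2).intervalIntegrable _ _)]
  have h1 : phase L k L = Real.pi := by
    have := phase_add hL hk 0
    rwa [zero_add, phase_zero hk, zero_add] at this
  rw [phase_zero hk, h1, integral_zero_pi_eq_two_mul hc (legendreDelta_pi_sub k)]
  change _ * (2 * ellipticE k) - _ = _
  rw [intervalIntegral.integral_same]
  field_simp
  ring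

/-- The profile is affine in Δ² along the phase, so its mean involves only E/K. -/
theorem moment_one (hL : L ≠ 0) (hk : k ∈ Ioo (0 : ℝ) 1) :
    moment L k 1 = L * (6 / 5 * meanSq k) := by
  have hk' := mem_Ioo_neg_one_one hk
  have hphase : Continuous (phase L k) :=
    continuous_iff_continuousAt.2 fun x => (hasDerivAt_phase hk x).continuousAt
  have hc : Continuous fun x => legendreDelta k (phase L k x) ^ 2 :=
    ((continuous_legendreDelta k).comp hphase).pow 2
  have e : ∀ x, profile L k x ^ 1 = 5 / (12 * modS k) * (modS k + k ^ 2 - 2)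
      + 5 / (4 * modS k) * legendreDelta k (phase L k x) ^ 2 := fun x => by
    rw [legendreDelta_sq hk', Real.sin_sq, profile]
    have := (modS_pos k).ne'
    field_simp
    ring
  unfold moment
  simp only [e]
  rw [intervalIntegral.integral_add (intervalIntegrable_const)
    ((hc.const_mul _).intervalIntegrable _ _), intervalIntegral.integral_const,
    intervalIntegral.integral_const_mul, integral_legendreDelta_phase_sq hL hk, meanSq]
  simp only [sub_zero, smul_eq_mul]
  have := (modS_pos k).ne'
  field_simp
  ring

/-- The integrand is (ψⁿψ')' divided by P/L², with ψ'² and ψ'' replaced by polynomials in ψ;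
periodicity removes the boundary terms. -/
theorem integral_profile_recursion (hL : L ≠ 0) (hk : k ∈ Ioo (0 : ℝ) 1) (n : ℕ) :
    ∫ x in (0 : ℝ)..L, (n * profile L k x ^ (n - 1) *
        (profile L k x ^ 2 / 4 - profile L k x ^ 3 / 5 - normConst k / 2)
      + profile L k x ^ n * (profile L k x / 4 - 3 / 10 * profile L k x ^ 2)) = 0 := by
  have hr : thresholdFun k / L ^ 2 ≠ 0 := div_ne_zero (thresholdFun_pos hk).ne' (pow_ne_zero 2 hL)
  have hc := continuous_profile (L := L) hk
  have hd : ∀ x, HasDerivAt (fun x => (thresholdFun k / L ^ 2)⁻¹ *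
        (profile L k x ^ n * profileDx L k x))
      (n * profile L k x ^ (n - 1) *
        (profile L k x ^ 2 / 4 - profile L k x ^ 3 / 5 - normConst k / 2)
      + profile L k x ^ n * (profile L k x / 4 - 3 / 10 * profile L k x ^ 2)) x := fun x => by
    have h := (((hasDerivAt_profile (L := L) hk x).pow n).mul
      (hasDerivAt_profileDx (L := L) hk x)).const_mul (thresholdFun k / L ^ 2)⁻¹
    convert! h using 1
    have e := profileDx_sq (L := L) hk x
    rw [mul_assoc _ (profileDx L k x) (profileDx L k x), ← pow_two, e, Pi.pow_apply]
    generalize thresholdFun k / L ^ 2 = r at *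
    field_simp
  have hcont : Continuous fun x => (n * profile L k x ^ (n - 1) *
        (profile L k x ^ 2 / 4 - profile L k x ^ 3 / 5 - normConst k / 2)
      + profile L k x ^ n * (profile L k x / 4 - 3 / 10 * profile L k x ^ 2)) := by fun_prop
  rw [intervalIntegral.integral_eq_sub_of_hasDerivAt (fun x _ => hd x)
    (hcont.intervalIntegrable _ _)]
  have h1 := profile_periodic hL hk 0
  have h2 := profileDx_periodic hL hk 0
  rw [zero_add] at h1 h2
  rw [h1, h2, sub_self]

theorem moment_two (hL : L ≠ 0) (hk : k ∈ Ioo (0 : ℝ) 1) :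
    moment L k 2 = L * meanSq k := by
  have h := integral_profile_recursion hL hk 0
  rw [intervalIntegral.integral_congr (g := fun x => 1 / 4 * profile L k x ^ 1
      + (-3 / 10) * profile L k x ^ 2 + 0 * profile L k x ^ 0) (fun x _ => by push_cast; ring),
    integral_profile_combination hk, moment_one hL hk] at h
  linarith

theorem moment_three (hL : L ≠ 0) (hk : k ∈ Ioo (0 : ℝ) 1) :
    moment L k 3 = L * (meanSq k - normConst k) := by
  have h := integral_profile_recursion hL hk 1
  rw [intervalIntegral.integral_congr (g := fun x => 1 / 2 * profile L k x ^ 2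
      + (-1 / 2) * profile L k x ^ 3 + (-normConst k / 2) * profile L k x ^ 0)
      (fun x _ => by push_cast; ring),
    integral_profile_combination hk, moment_two hL hk, moment_zero] at h
  linarith

/-- The mean of the fourth power of the profile. -/
def meanFour (k : ℝ) : ℝ :=
  15 / 14 * (meanSq k - normConst k) - 12 / 7 * (normConst k * meanSq k)

theorem moment_four (hL : L ≠ 0) (hk : k ∈ Ioo (0 : ℝ) 1) :
    moment L k 4 = L * meanFour k := by
  have h := integral_profile_recursion hL hk 2
  rw [intervalIntegral.integral_congr (g := fun x => 3 / 4 * profile L k x ^ 3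
      + (-7 / 10) * profile L k x ^ 4 + (-normConst k) * profile L k x ^ 1)
      (fun x _ => by push_cast; ring),
    integral_profile_combination hk, moment_three hL hk, moment_one hL hk] at h
  rw [meanFour]
  linarith

theorem moment_five (hL : L ≠ 0) (hk : k ∈ Ioo (0 : ℝ) 1) :
    moment L k 5 = L * (10 / 9 * meanFour k - 5 / 3 * (normConst k * meanSq k)) := by
  have h := integral_profile_recursion hL hk 3
  rw [intervalIntegral.integral_congr (g := fun x => 1 * profile L k x ^ 4
      + (-9 / 10) * profile L k x ^ 5 + (-3 / 2 * normConst k) * profile L k x ^ 2)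
      (fun x _ => by push_cast; ring),
    integral_profile_combination hk, moment_four hL hk, moment_two hL hk] at h
  linarith

/-! ### The conserved quantities along the curve -/

theorem wave_eq_fun (hk : k ∈ admissible L) : wave L k = fun x => waveRoot L k x ^ 2 :=
  funext (wave_eq hk)

theorem hasDerivAt_wave (hk : k ∈ admissible L) (x : ℝ) :
    HasDerivAt (wave L k) (2 * ampl L k ^ 2 * (profile L k x * profileDx L k x)) x := by
  rw [wave_eq_fun hk]
  have h := ((hasDerivAt_profile (L := L) hk.1 x).const_mul (ampl L k)).pow 2
  convert! h using 1
  norm_num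
  ring

theorem functionalV_wave (hL : L ≠ 0) (hk : k ∈ admissible L) :
    functionalV L (wave L k) = L * (ampl L k ^ 2 * meanSq k) := by
  unfold functionalV
  rw [intervalIntegral.integral_congr (g := fun x => ampl L k ^ 2 * profile L k x ^ 2
    + 0 * profile L k x ^ 0 + 0 * profile L k x ^ 0)
    (fun x _ => by simp only [wave_eq hk, waveRoot]; ring),
    integral_profile_combination hk.1, moment_two hL hk.1]
  ring

theorem functionalQ_wave (hL : L ≠ 0) (hk : k ∈ admissible L) :
    functionalQ L (wave L k) = L * (ampl L k ^ 4 * meanFour k / 2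
      + ampl L k ^ 5 / (1 + ampl L k) * (meanFour k / 18 - normConst k * meanSq k / 3)) := by
  unfold functionalQ
  have hr := ampl_eq_mul hL hk
  have hy := ampl_pos hk
  have hr' : thresholdFun k / L ^ 2 = ampl L k / (1 + ampl L k) := by
    rw [eq_div_iff (by positivity), mul_comm]; exact hr.symm
  rw [intervalIntegral.integral_congr
    (g := fun x => ampl L k ^ 4 * (1 + thresholdFun k / L ^ 2) * profile L k x ^ 4
    + (-4 / 5 * ampl L k ^ 4 * (thresholdFun k / L ^ 2)) * profile L k x ^ 5
    + (-2 * ampl L k ^ 4 * (thresholdFun k / L ^ 2) * normConst k) * profile L k x ^ 2)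
    (fun x _ => by
      simp only [(hasDerivAt_wave hk x).deriv, wave_eq hk, waveRoot]
      rw [mul_pow, mul_pow, mul_pow, mul_pow, mul_pow, profileDx_sq hk.1]; ring),
    integral_profile_combination hk.1, moment_four hL hk.1, moment_five hL hk.1,
    moment_two hL hk.1, hr']
  field_simp
  ring

end Moments

/-! ### Joint smoothness and the linearized equation -/

section Joint

variable {L : ℝ}

/-- The wave as a function of the modulus and the position. -/
def waveFn (L : ℝ) (p : ℝ × ℝ) : ℝ := waveRoot L p.1 p.2 ^ 2

theorem contDiffOn_thresholdFun : ContDiffOn ℝ ∞ thresholdFun (Ioo (-1 : ℝ) 1) :=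
  (contDiffOn_const.mul (contDiffOn_ellipticK.pow 2)).mul contDiff_modS.contDiffOn

theorem admissible_subset : admissible L ⊆ Ioo (-1 : ℝ) 1 := fun _ hk => mem_Ioo_neg_one_one hk.1

theorem contDiffOn_ampl : ContDiffOn ℝ ∞ (ampl L) (admissible L) := by
  have h := contDiffOn_thresholdFun.mono (admissible_subset (L := L))
  exact h.div (contDiffOn_const.sub h) fun k hk => hk.2.ne'

theorem contDiffOn_waveRoot :
    ContDiffOn ℝ ∞ (fun p : ℝ × ℝ => waveRoot L p.1 p.2) (admissible L ×ˢ univ) := by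
  have hfst : MapsTo (Prod.fst : ℝ × ℝ → ℝ) (admissible L ×ˢ univ) (admissible L) :=
    fun p hp => hp.1
  have hA : ContDiffOn ℝ ∞ (fun p : ℝ × ℝ => ampl L p.1) (admissible L ×ˢ univ) :=
    contDiffOn_ampl.comp contDiffOn_fst hfst
  have hK : ContDiffOn ℝ ∞ (fun p : ℝ × ℝ => ellipticK p.1) (admissible L ×ˢ univ) :=
    (contDiffOn_ellipticK.mono admissible_subset).comp contDiffOn_fst hfst
  have hS : ContDiffOn ℝ ∞ (fun p : ℝ × ℝ => modS p.1) (admissible L ×ˢ univ) :=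
    (contDiff_modS.comp contDiff_fst).contDiffOn
  have hph : ContDiffOn ℝ ∞ (fun p : ℝ × ℝ => phase L p.1 p.2) (admissible L ×ˢ univ) :=
    contDiffOn_jacobiAm.comp (g := fun p : ℝ × ℝ => jacobiAm p.1 p.2)
      (f := fun p : ℝ × ℝ => (p.1, 2 * ellipticK p.1 / L * p.2))
      (contDiffOn_fst.prodMk (((contDiffOn_const.mul hK).div_const L).mul contDiffOn_snd))
      fun p hp => ⟨admissible_subset hp.1, mem_univ _⟩
  have hsq : ContDiffOn ℝ ∞ (fun p : ℝ × ℝ => p.1 ^ 2) (admissible L ×ˢ univ) :=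
    (contDiff_fst.pow 2).contDiffOn
  refine hA.mul ((contDiffOn_const.div (contDiffOn_const.mul hS)
    fun p _ => mul_ne_zero (by norm_num) (modS_pos p.1).ne').mul ?_)
  exact ((hS.add contDiffOn_const).sub (contDiffOn_const.mul hsq)).add
    ((contDiffOn_const.mul hsq).mul (hph.cos.pow 2))

theorem contDiffOn_waveFn : ContDiffOn ℝ ∞ (waveFn L) (admissible L ×ˢ univ) :=
  contDiffOn_waveRoot.pow 2

variable {k : ℝ}

theorem waveFn_eq (hk : k ∈ admissible L) (x : ℝ) : waveFn L (k, x) = wave L k x :=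
  (wave_eq hk x).symm

theorem hasDerivAt_wave_modulus (hk : k ∈ admissible L) (x : ℝ) :
    HasDerivAt (fun κ => wave L κ x) (pd1 (waveFn L) (k, x)) k := by
  refine (hasDerivAt_fst (p := (k, x)) (differentiableAt_of_contDiffOn_strip
    (isOpen_admissible L) contDiffOn_waveFn hk)).congr_of_eventuallyEq ?_
  filter_upwards [(isOpen_admissible L).mem_nhds hk] with κ hκ using (waveFn_eq hκ x).symm

theorem waveDk_eq (hk : k ∈ admissible L) : waveDk L k = fun x => pd1 (waveFn L) (k, x) :=
  funext fun x => (hasDerivAt_wave_modulus hk x).deriv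

theorem contDiff_waveDk (hk : k ∈ admissible L) : ContDiff ℝ ∞ (waveDk L k) := by
  rw [waveDk_eq hk]
  exact contDiff_slice (contDiffOn_pd1 (isOpen_admissible L) contDiffOn_waveFn) hk

theorem wave_periodic (hL : L ≠ 0) (hk : k ∈ admissible L) : Function.Periodic (wave L k) L :=
  fun x => by simp only [wave_eq hk, waveRoot, profile_periodic hL hk.1 x]

theorem waveDk_periodic (hL : L ≠ 0) (hk : k ∈ admissible L) :
    Function.Periodic (waveDk L k) L := fun x => by
  refine EventuallyEq.deriv_eq ?_
  filter_upwards [(isOpen_admissible L).mem_nhds hk] with κ hκ using wave_periodic hL hκ x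

theorem contDiff_wave (hk : k ∈ admissible L) : ContDiff ℝ ∞ (wave L k) := by
  have := contDiff_slice (contDiffOn_waveFn (L := L)) hk
  simpa only [waveFn_eq hk] using this

theorem deriv_slice {f : ℝ × ℝ → ℝ} (hf : ContDiffOn ℝ ∞ f (admissible L ×ˢ univ))
    (hk : k ∈ admissible L) : deriv (fun x => f (k, x)) = fun x => pd2 f (k, x) :=
  funext fun x => (hasDerivAt_snd (p := (k, x))
    (differentiableAt_of_contDiffOn_strip (isOpen_admissible L) hf hk)).deriv

theorem deriv_deriv_slice {f : ℝ × ℝ → ℝ} (hf : ContDiffOn ℝ ∞ f (admissible L ×ˢ univ))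
    (hk : k ∈ admissible L) :
    deriv (deriv fun x => f (k, x)) = fun x => pd2 (pd2 f) (k, x) := by
  rw [deriv_slice hf hk, deriv_slice (contDiffOn_pd2 (isOpen_admissible L) hf) hk]

theorem wave_eq_slice (hk : k ∈ admissible L) : wave L k = fun x => waveFn L (k, x) :=
  funext fun x => (waveFn_eq hk x).symm

/-- φ'' = 2y²(ψ'² + ψψ''), and the relation (1 + y)P/L² = y turns this into the travelling wave
equation. -/
theorem deriv_deriv_wave (hL : L ≠ 0) (hk : k ∈ admissible L) (x : ℝ) :
    waveSpeed L k * deriv (deriv (wave L k)) x = (waveSpeed L k - 1) * wave L k x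
      - waveRoot L k x ^ 3 + intConst L k := by
  have h1 : deriv (wave L k) = fun x => 2 * ampl L k ^ 2 * (profile L k x * profileDx L k x) :=
    funext fun x => (hasDerivAt_wave hk x).deriv
  have h2 := ((hasDerivAt_profile (L := L) hk.1 x).mul
    (hasDerivAt_profileDx (L := L) hk.1 x)).const_mul (2 * ampl L k ^ 2)
  have h3 : deriv (fun x => 2 * ampl L k ^ 2 * (profile L k x * profileDx L k x)) x = _ := h2.deriv
  rw [h1, h3, ← pow_two, profileDx_sq hk.1, waveSpeed_eq hk, intConst_eq hk, wave_eq hk, waveRoot]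
  have hr := ampl_eq_mul hL hk
  generalize thresholdFun k / L ^ 2 = r at *
  generalize ampl L k = y at *
  linear_combination (-(2 * y ^ 2) * (profile L k x ^ 2 / 4 - profile L k x ^ 3 / 5
    - normConst k / 2 + profile L k x * (profile L k x / 4 - 3 / 10 * profile L k x ^ 2))) * hr

/-- The k-derivative of the travelling wave equation. Writing φ^{3/2} as the cube of `waveRoot`
avoids differentiating a square root. -/
theorem linOp_waveDk (hL : L ≠ 0) (hk : k ∈ admissible L) (x : ℝ) :
    linOp L k (waveDk L k) x = -(deriv (waveSpeed L) k *
      (wave L k x - deriv (deriv (wave L k)) x) + deriv (intConst L) k) := by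
  have hI := isOpen_admissible L
  have hw := contDiffOn_waveFn (L := L)
  have hd : ∀ {f : ℝ × ℝ → ℝ}, ContDiffOn ℝ ∞ f (admissible L ×ˢ univ) →
      HasDerivAt (fun κ => f (κ, x)) (pd1 f (k, x)) k := fun hf =>
    hasDerivAt_fst (p := (k, x)) (differentiableAt_of_contDiffOn_strip hI hf hk)
  have hc := (hasDerivAt_waveSpeed hk).differentiableAt.hasDerivAt
  have hA := (hasDerivAt_intConst hk).differentiableAt.hasDerivAt
  have hroot := hd contDiffOn_waveRoot
  have hlhs := hc.mul (hd (contDiffOn_pd2 hI (contDiffOn_pd2 hI hw)))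
  have hrhs := (((hc.sub_const 1).mul (hd hw)).sub (hroot.pow 3)).add hA
  have heq := hlhs.unique (hrhs.congr_of_eventuallyEq (by
    filter_upwards [hI.mem_nhds hk] with κ hκ
    have := deriv_deriv_wave hL hκ x
    rw [wave_eq_slice hκ, deriv_deriv_slice hw hκ] at this
    exact this))
  have hsq : pd1 (waveFn L) (k, x) = 2 * waveRoot L k x *
      pd1 (fun p : ℝ × ℝ => waveRoot L p.1 p.2) (k, x) := by
    rw [(hd hw).unique (hroot.pow 2)]
    norm_num
  have hcomm : pd1 (pd2 (pd2 (waveFn L))) (k, x) = pd2 (pd2 (pd1 (waveFn L))) (k, x) := by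
    rw [pd1_pd2_comm hI (contDiffOn_pd2 hI hw) (p := (k, x)) hk]
    have h1 := deriv_slice (contDiffOn_pd1 hI (contDiffOn_pd2 hI hw)) hk
    have h2 := deriv_slice (contDiffOn_pd2 hI (contDiffOn_pd1 hI hw)) hk
    have e : (fun x => pd1 (pd2 (waveFn L)) (k, x)) = fun x => pd2 (pd1 (waveFn L)) (k, x) :=
      funext fun x => pd1_pd2_comm hI hw (p := (k, x)) hk
    rw [e, h2] at h1
    exact (congrFun h1 x).symm
  unfold linOp
  rw [waveDk_eq hk, deriv_deriv_slice (contDiffOn_pd1 hI hw) hk, sqrt_wave hk, wave_eq_slice hk,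
    deriv_deriv_slice hw hk]
  beta_reduce
  rw [← hcomm]
  simp only [Nat.cast_ofNat, Nat.add_one_sub_one] at heq
  have e3 : 3 / 2 * waveRoot L k x * pd1 (waveFn L) (k, x)
      = 3 * waveRoot L k x ^ 2 * pd1 (fun p : ℝ × ℝ => waveRoot L p.1 p.2) (k, x) := by
    rw [hsq]; ring
  rw [e3]
  linarith

/-! ### Derivatives of the conserved quantities along the curve -/

theorem hasDerivAt_functionalV (hk : k ∈ admissible L) :
    HasDerivAt (fun κ => functionalV L (wave L κ)) (∫ x in (0 : ℝ)..L, waveDk L k x) k := by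
  have h := hasDerivAt_integral_fst (isOpen_admissible L) contDiffOn_waveFn hk 0 L
  rw [waveDk_eq hk]
  refine h.congr_of_eventuallyEq ?_
  filter_upwards [(isOpen_admissible L).mem_nhds hk] with κ hκ
  rw [wave_eq_slice hκ]; rfl

/-- Differentiation under the integral, then integration by parts over a period, so that the
derivative appears as a pairing with φ - φ''. -/
theorem hasDerivAt_functionalQ (hL : L ≠ 0) (hk : k ∈ admissible L) :
    HasDerivAt (fun κ => functionalQ L (wave L κ))
      (∫ x in (0 : ℝ)..L, (wave L k x - deriv (deriv (wave L k)) x) * waveDk L k x) k := by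
  have hI := isOpen_admissible L
  have hw := contDiffOn_waveFn (L := L)
  have hw2 := contDiffOn_pd2 hI hw
  have h := (hasDerivAt_integral_fst hI ((hw.pow 2).add (hw2.pow 2)) hk 0 L).const_mul (1 / 2)
  have h' : HasDerivAt (fun κ => functionalQ L (wave L κ)) _ k := h.congr_of_eventuallyEq (by
    filter_upwards [hI.mem_nhds hk] with κ hκ
    unfold functionalQ
    rw [wave_eq_slice hκ, deriv_slice hw hκ])
  convert! h' using 1
  have hpd : ∀ x, pd1 (fun p => waveFn L p ^ 2 + pd2 (waveFn L) p ^ 2) (k, x)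
      = 2 * (wave L k x * waveDk L k x + deriv (wave L k) x * deriv (waveDk L k) x) := fun x => by
    have hd : ∀ {f : ℝ × ℝ → ℝ}, ContDiffOn ℝ ∞ f (admissible L ×ˢ univ) →
        HasDerivAt (fun κ => f (κ, x)) (pd1 f (k, x)) k := fun hf =>
      hasDerivAt_fst (p := (k, x)) (differentiableAt_of_contDiffOn_strip hI hf hk)
    rw [(hd ((hw.pow 2).add (hw2.pow 2))).unique (((hd hw).pow 2).add ((hd hw2).pow 2)),
      waveDk_eq hk, deriv_slice (contDiffOn_pd1 hI hw) hk, wave_eq_slice hk, deriv_slice hw hk,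
      pd1_pd2_comm hI hw (p := (k, x)) hk]
    norm_num
    ring
  simp only [hpd]
  have hwc := contDiff_wave hk
  have hvc := contDiff_waveDk hk
  have hw' : ContDiff ℝ ∞ (deriv (wave L k)) := (contDiff_infty_iff_deriv.1 hwc).2
  have hw'' : ContDiff ℝ ∞ (deriv (deriv (wave L k))) := (contDiff_infty_iff_deriv.1 hw').2
  have hv' : ContDiff ℝ ∞ (deriv (waveDk L k)) := (contDiff_infty_iff_deriv.1 hvc).2
  have hparts := intervalIntegral.integral_mul_deriv_eq_deriv_mul (a := 0) (b := L)
    (u := deriv (wave L k)) (v := waveDk L k) (u' := deriv (deriv (wave L k)))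
    (v' := deriv (waveDk L k))
    (fun x _ => (hw'.differentiable (by simp) x).hasDerivAt)
    (fun x _ => (hvc.differentiable (by simp) x).hasDerivAt)
    (hw''.continuous.intervalIntegrable _ _) (hv'.continuous.intervalIntegrable _ _)
  have hp1 := waveDk_periodic hL hk 0
  have hp2 : deriv (wave L k) (0 + L) = deriv (wave L k) 0 := by
    rw [(hasDerivAt_wave hk _).deriv, (hasDerivAt_wave hk _).deriv, profile_periodic hL hk.1 0,
      profileDx_periodic hL hk.1 0]
  rw [zero_add] at hp1 hp2
  rw [hp1, hp2, sub_self, zero_sub] at hparts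
  have i1 : IntervalIntegrable (fun x => wave L k x * waveDk L k x) volume 0 L :=
    (hwc.continuous.mul hvc.continuous).intervalIntegrable _ _
  have i2 : IntervalIntegrable (fun x => deriv (wave L k) x * deriv (waveDk L k) x) volume 0 L :=
    (hw'.continuous.mul hv'.continuous).intervalIntegrable _ _
  have i3 : IntervalIntegrable (fun x => deriv (deriv (wave L k)) x * waveDk L k x) volume 0 L :=
    (hw''.continuous.mul hvc.continuous).intervalIntegrable _ _
  rw [intervalIntegral.integral_const_mul, intervalIntegral.integral_add i1 i2, hparts]
  simp only [sub_mul]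
  rw [intervalIntegral.integral_sub i1 i3]
  ring

end Joint

/-! ### The gradient of the functional -/

section Gradient

variable {L : ℝ}

theorem memLp_two_of_continuous {f : ℝ → ℝ} (hf : Continuous f) (L : ℝ) :
    MemLp f 2 (volume.restrict (Ioc 0 L)) := by
  obtain ⟨C, hC⟩ := (isCompact_Icc (a := (0 : ℝ)) (b := L)).exists_bound_of_continuousOn
    hf.continuousOn
  refine MemLp.of_bound hf.aestronglyMeasurable C ?_
  filter_upwards [ae_restrict_mem measurableSet_Ioc] with x hx using hC x (Ioc_subset_Icc_self hx)

theorem deriv_periodic {f : ℝ → ℝ} (hf : Function.Periodic f L) :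
    Function.Periodic (deriv f) L := fun x => by
  rw [← deriv_comp_add_const, show (fun x => f (x + L)) = f from funext hf]

theorem absolutelyContinuousOnInterval_of_contDiff {f : ℝ → ℝ} (hf : ContDiff ℝ ∞ f) (a b : ℝ) :
    AbsolutelyContinuousOnInterval f a b :=
  ((hf.of_le (by exact_mod_cast le_top)).contDiffOn).absolutelyContinuousOnInterval

theorem memH1per_of_contDiff {u : ℝ → ℝ} (hu : ContDiff ℝ ∞ u) (hp : Function.Periodic u L) :
    MemH1per L u :=
  ⟨hp, absolutelyContinuousOnInterval_of_contDiff hu 0 L,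
    memLp_two_of_continuous (contDiff_infty_iff_deriv.1 hu).2.continuous L⟩

theorem integral_sq_add_deriv_sq_add (hL : 0 < L) {u h : ℝ → ℝ} (hu : ContDiff ℝ ∞ u)
    (hp : Function.Periodic u L) (hh : MemH1per L h) :
    ∫ x in (0 : ℝ)..L, ((u + h) x ^ 2 + deriv (u + h) x ^ 2)
      = (∫ x in (0 : ℝ)..L, (u x ^ 2 + deriv u x ^ 2))
        + 2 * (∫ x in (0 : ℝ)..L, (u x - deriv (deriv u) x) * h x)
        + ∫ x in (0 : ℝ)..L, (h x ^ 2 + deriv h x ^ 2) := by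
  obtain ⟨hhp, hac, hLp⟩ := hh
  have hu' : ContDiff ℝ ∞ (deriv u) := (contDiff_infty_iff_deriv.1 hu).2
  have hu'' : ContDiff ℝ ∞ (deriv (deriv u)) := (contDiff_infty_iff_deriv.1 hu').2
  have hhc : ContinuousOn h (uIcc 0 L) := hac.continuousOn
  have hi := hac.intervalIntegrable_deriv
  have i1 : IntervalIntegrable (fun x => u x ^ 2 + deriv u x ^ 2) volume 0 L :=
    ((hu.continuous.pow 2).add (hu'.continuous.pow 2)).intervalIntegrable _ _
  have i2 : IntervalIntegrable (fun x => u x * h x) volume 0 L :=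
    (hu.continuous.continuousOn.mul hhc).intervalIntegrable
  have i3 : IntervalIntegrable (fun x => deriv u x * deriv h x) volume 0 L :=
    hi.continuousOn_mul hu'.continuous.continuousOn
  have i4 : IntervalIntegrable (fun x => h x ^ 2 + deriv h x ^ 2) volume 0 L :=
    ((hhc.pow 2).intervalIntegrable).add
      ((intervalIntegrable_iff_integrableOn_Ioc_of_le hL.le).2 hLp.integrable_sq)
  have i5 : IntervalIntegrable (fun x => deriv (deriv u) x * h x) volume 0 L :=
    (hu''.continuous.continuousOn.mul hhc).intervalIntegrable
  have hcongr : ∫ x in (0 : ℝ)..L, ((u + h) x ^ 2 + deriv (u + h) x ^ 2)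
      = ∫ x in (0 : ℝ)..L, ((u x ^ 2 + deriv u x ^ 2) + 2 * (u x * h x + deriv u x * deriv h x)
        + (h x ^ 2 + deriv h x ^ 2)) := by
    -- An absolutely continuous `h` is differentiable only almost everywhere.
    refine intervalIntegral.integral_congr_ae ?_
    filter_upwards [hac.ae_differentiableAt] with x hx hxI
    rw [deriv_add (hu.differentiable (by simp) x) (hx (uIoc_subset_uIcc hxI)), Pi.add_apply]
    ring
  have hparts := (absolutelyContinuousOnInterval_of_contDiff hu' 0 L
    ).integral_mul_deriv_eq_deriv_mul hac
  have hp1 := deriv_periodic hp 0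
  have hp2 := hhp 0
  rw [zero_add] at hp1 hp2
  rw [hp1, hp2, sub_self, zero_sub] at hparts
  rw [hcongr, intervalIntegral.integral_add (i1.add ((i2.add i3).const_mul 2)) i4,
    intervalIntegral.integral_add i1 ((i2.add i3).const_mul 2),
    intervalIntegral.integral_const_mul, intervalIntegral.integral_add i2 i3, hparts]
  simp only [sub_mul]
  rw [intervalIntegral.integral_sub i2 i5]
  ring

/-- The `L²` gradient of `M_k` at a smooth periodic function. -/
def gradM (L k : ℝ) (u : ℝ → ℝ) (x : ℝ) : ℝ :=
  deriv (waveSpeed L) k * (u x - deriv (deriv u) x) + deriv (intConst L) k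

theorem continuous_gradM {u : ℝ → ℝ} (hu : ContDiff ℝ ∞ u) (k : ℝ) :
    Continuous (gradM L k u) := by
  have hu' : ContDiff ℝ ∞ (deriv u) := (contDiff_infty_iff_deriv.1 hu).2
  have hu'' : ContDiff ℝ ∞ (deriv (deriv u)) := (contDiff_infty_iff_deriv.1 hu').2
  exact (continuous_const.mul (hu.continuous.sub hu''.continuous)).add continuous_const

theorem innerPer_gradM {u h : ℝ → ℝ} (hu : ContDiff ℝ ∞ u) (k : ℝ)
    (hh : ContinuousOn h (uIcc 0 L)) :
    innerPer L (gradM L k u) h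
      = deriv (waveSpeed L) k * (∫ x in (0 : ℝ)..L, (u x - deriv (deriv u) x) * h x)
        + deriv (intConst L) k * ∫ x in (0 : ℝ)..L, h x := by
  have hu' : ContDiff ℝ ∞ (deriv u) := (contDiff_infty_iff_deriv.1 hu).2
  have hu'' : ContDiff ℝ ∞ (deriv (deriv u)) := (contDiff_infty_iff_deriv.1 hu').2
  have i1 : IntervalIntegrable (fun x => (u x - deriv (deriv u) x) * h x) volume 0 L :=
    ((hu.continuous.sub hu''.continuous).continuousOn.mul hh).intervalIntegrable
  unfold innerPer gradM
  rw [← intervalIntegral.integral_const_mul, ← intervalIntegral.integral_const_mul,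
    ← intervalIntegral.integral_add (i1.const_mul _) (hh.intervalIntegrable.const_mul _)]
  exact intervalIntegral.integral_congr fun x _ => by ring

/-- V is linear and Q quadratic, so the remainder is exactly (c'/2)‖h‖². -/
theorem hasGradientPer_functionalM (hL : 0 < L) {u : ℝ → ℝ} (hu : ContDiff ℝ ∞ u)
    (hp : Function.Periodic u L) (k : ℝ) :
    HasGradientPer L (functionalM L k) (gradM L k u) u := by
  refine ⟨memH1per_of_contDiff hu hp, ⟨fun x => ?_,
    memLp_two_of_continuous (continuous_gradM hu k) L⟩, fun ε hε => ?_⟩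
  · simp only [gradM, hp x, deriv_periodic (deriv_periodic hp) x]
  set c := deriv (waveSpeed L) k with hc
  -- The summand 1 keeps the denominator nonzero when c' = 0.
  refine ⟨ε / (|c| + 1), by positivity, fun h hh hδ => ?_⟩
  have hhc : ContinuousOn h (uIcc 0 L) := hh.2.1.continuousOn
  have hV : functionalV L (u + h) = functionalV L u + ∫ x in (0 : ℝ)..L, h x :=
    intervalIntegral.integral_add (hu.continuous.intervalIntegrable _ _) hhc.intervalIntegrable
  have hN0 : 0 ≤ ∫ x in (0 : ℝ)..L, (h x ^ 2 + deriv h x ^ 2) :=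
    intervalIntegral.integral_nonneg hL.le fun x _ => by positivity
  have hN : normH1per L h ^ 2 = ∫ x in (0 : ℝ)..L, (h x ^ 2 + deriv h x ^ 2) := Real.sq_sqrt hN0
  have hNn : 0 ≤ normH1per L h := Real.sqrt_nonneg _
  have hdiff : functionalM L k (u + h) - functionalM L k u - innerPer L (gradM L k u) h
      = c / 2 * normH1per L h ^ 2 := by
    rw [innerPer_gradM hu k hhc, functionalM, functionalM, hV, functionalQ, functionalQ,
      integral_sq_add_deriv_sq_add hL hu hp hh, hN]
    ring
  rw [hdiff, abs_mul, abs_of_nonneg (sq_nonneg (normH1per L h)), abs_div, abs_two]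
  rw [lt_div_iff₀ (by positivity)] at hδ
  nlinarith [abs_nonneg c, mul_nonneg hNn hNn, mul_nonneg (abs_nonneg c) hNn,
    mul_le_mul_of_nonneg_left hδ.le hNn]

end Gradient

/-! ### Positivity -/

/-- The quadratic polynomial in the wave speed that carries the sign. -/
theorem speed_polynomial_pos {a v l Y : ℝ} (ha : a ∈ Ioo (0 : ℝ) (25 / 216)) (hd : 0 < v - 6 * a)
    (hl : l = (v - 6 * a) / (36 * a * (25 / 216 - a)))
    (hb : 972 / 25 * (25 / 216 - a) ^ 2 * a ≤ (v - 6 * a) ^ 2) (hY : 1 < Y) :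
    0 < 4 * l ^ 2 * (50 * (v - a) - 234 * a * v) / 21 * Y ^ 2
      + 2 * l * (23 / 7 * v + 30 / 7 * a * (1 + l * (v - 6 * a))
        - l * (25 / 42 * (v - 6 * a) + 5 / 14 * (v - a) - 18 / 7 * a * v)) * Y
      + (-4 * l ^ 2 * (5 / 84 * (v - a) - 3 / 7 * a * v)
        + 2 * l * (5 / 84 * l * (v - 6 * a) - 3 / 7 * (v + a + a * l * (v - 6 * a)))
        - (1 + l * (v - 6 * a))) := by
  -- Normalized variables: α ∈ (0, 1) is a relative to its maximal level, and g rescales v - 6a so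
  -- that l = 6g/(5α) and the bound `hb` becomes g² ≥ 9α/50.
  obtain ⟨α, rfl⟩ : ∃ α, a = 25 / 216 * α := ⟨216 / 25 * a, by ring⟩
  have h0 : 0 < α := by have := ha.1; linarith
  have h1 : α < 1 := by have := ha.2; linarith
  have hβ : 0 < 1 - α := by linarith
  obtain ⟨g, rfl⟩ : ∃ g, v = 25 / 216 * (6 * α + 5 * (1 - α) * g) :=
    ⟨(216 / 25 * v - 6 * α) / (5 * (1 - α)), by field_simp; ring⟩
  have hg : 0 < g := by
    have : 0 < (1 - α) * g := by linarith
    exact (pos_iff_pos_of_mul_pos this).1 hβ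
  have hg2 : 9 / 50 * α ≤ g ^ 2 := by
    have : (1 - α) ^ 2 * (9 / 50 * α) ≤ (1 - α) ^ 2 * g ^ 2 := by linarith
    exact le_of_mul_le_mul_left this (pow_pos hβ 2)
  have hl' : l = 6 / 5 * (g / α) := by
    rw [hl]; field_simp; ring
  subst hl'
  -- Times α², the polynomial is a quadratic in y whose coefficients, from the leading one down, are
  -- the quantities in `hA`, `hB`, `hC`. The only negative term is the -α inside `hC`.
  obtain ⟨y, rfl⟩ : ∃ y, Y = 1 + y := ⟨Y - 1, by ring⟩
  have hy : 0 < y := by linarith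
  have hA : 0 < g ^ 3 * ((1 - α) * (500 / 63 - 1625 / 378 * α))
      + α * g ^ 2 * (500 / 63 - 325 / 63 * α) := by
    have e1 : 0 < 500 / 63 - 1625 / 378 * α := by linarith
    have e2 : 0 < 500 / 63 - 325 / 63 * α := by linarith
    positivity
  have hB : 0 < g ^ 3 * ((1 - α) * (100 / 7 - 1375 / 189 * α))
      + α * g ^ 2 * (1250 / 63 - 100 / 7 * α) + 20 / 3 * α ^ 2 * g := by
    have e1 : 0 < 100 / 7 - 1375 / 189 * α := by linarith
    have e2 : 0 < 1250 / 63 - 100 / 7 * α := by linarith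
    positivity
  have hC : 0 < g ^ 3 * ((1 - α) * (25 / 4 - 625 / 216 * α))
      + α * (g ^ 2 * (125 / 12 - 275 / 36 * α) + 35 / 6 * α * g - α) := by
    have e1 : 0 < 25 / 4 - 625 / 216 * α := by linarith
    have e2 : 0 < 125 / 12 - 275 / 36 * α := by linarith
    have e3 : 2 / 5 * α ≤ g := by
      refine abs_le_of_sq_le_sq' ?_ hg.le |>.2
      nlinarith
    -- The lower bounds g² ≥ 9α/50 and g ≥ 2α/5 give at least α(7/8 + 23α/24).
    have e4 : 0 < g ^ 2 * (125 / 12 - 275 / 36 * α) + 35 / 6 * α * g - α := by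
      nlinarith [mul_le_mul_of_nonneg_right hg2 e2.le, mul_le_mul_of_nonneg_left e3 h0.le,
        mul_pos h0 hβ, mul_pos h0 h0]
    have e5 := mul_pos (pow_pos hg 3) (mul_pos hβ e1)
    have e6 := mul_pos h0 e4
    linarith
  have key := add_pos (add_pos (mul_pos hA (pow_pos hy 2)) (mul_pos hB hy)) hC
  have := div_pos key (pow_pos h0 2)
  convert! this using 1
  field_simp
  ring

section Final

variable {L k : ℝ}

/-- The k-derivatives of Q and V are known both as pairings with ∂_kφ and from their closed forms in
y, a, v; uniqueness of the derivative replaces the pairings by explicit expressions. -/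
theorem quantity_pos (hL : 0 < L) (hk : k ∈ admissible L) :
    0 < innerPer L (gradM L k (wave L k)) (waveDk L k) := by
  rw [innerPer_gradM (contDiff_wave hk) k (contDiff_waveDk hk).continuous.continuousOn]
  have hy := hasDerivAt_ampl hk
  have ha := hasDerivAt_normConst k
  have hv := hasDerivAt_meanSq hk.1
  have hyp := ampl_pos hk
  have hm4 := ((hv.sub ha).const_mul (15 / 14)).sub ((ha.mul hv).const_mul (12 / 7))
  have hQ := (((hy.pow 4).mul hm4).div_const 2).add
    (((hy.pow 5).div (hy.const_add 1) (by positivity)).mul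
      ((hm4.div_const 18).sub ((ha.mul hv).div_const 3))) |>.const_mul L
  have hV := ((hy.pow 2).mul hv).const_mul L
  have hnear := (isOpen_admissible L).mem_nhds hk
  have hQ' := (hasDerivAt_functionalQ hL.ne' hk).unique (hQ.congr_of_eventuallyEq (by
    filter_upwards [hnear] with κ hκ using functionalQ_wave hL.ne' hκ))
  have hV' := (hasDerivAt_functionalV hk).unique (hV.congr_of_eventuallyEq (by
    filter_upwards [hnear] with κ hκ using functionalV_wave hL.ne' hκ))
  have hpos := speed_polynomial_pos (normConst_mem hk.1) (excess_bounds hk.1).1 rfl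
    (excess_bounds hk.1).2 (show 1 < 1 + ampl L k by linarith)
  have ha1 := normConstDeriv_neg hk.1
  rw [hQ', hV', (hasDerivAt_waveSpeed hk).deriv, (hasDerivAt_intConst hk).deriv]
  have hfac : 0 < L * normConstDeriv k ^ 2 * ampl L k ^ 5 := by
    have := pow_pos (neg_pos.2 ha1) 2
    rw [neg_sq] at this
    positivity
  have := mul_pos hfac hpos
  convert! this using 1
  change _ = L * normConstDeriv k ^ 2 * ampl L k ^ 5 *
    (4 * periodRate k ^ 2 * (50 * (meanSq k - normConst k) - 234 * normConst k * meanSq k) / 21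
      * (1 + ampl L k) ^ 2
    + 2 * periodRate k * (23 / 7 * meanSq k + 30 / 7 * normConst k *
        (1 + periodRate k * (meanSq k - 6 * normConst k))
      - periodRate k * (25 / 42 * (meanSq k - 6 * normConst k)
        + 5 / 14 * (meanSq k - normConst k) - 18 / 7 * normConst k * meanSq k)) * (1 + ampl L k)
    + (-4 * periodRate k ^ 2 * (5 / 84 * (meanSq k - normConst k)
        - 3 / 7 * normConst k * meanSq k)
      + 2 * periodRate k * (5 / 84 * periodRate k * (meanSq k - 6 * normConst k)
        - 3 / 7 * (meanSq k + normConst k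
          + normConst k * periodRate k * (meanSq k - 6 * normConst k)))
      - (1 + periodRate k * (meanSq k - 6 * normConst k))))
  simp only [Nat.cast_ofNat, Nat.add_one_sub_one, pow_one, Pi.pow_apply, Pi.div_apply, Pi.mul_apply, Pi.sub_apply]
  generalize periodRate k = l
  generalize normConstDeriv k = a₁
  generalize normConst k = a
  generalize meanSq k = v
  generalize ampl L k = y at *
  have : 1 + y ≠ 0 := by positivity
  field_simp
  ring

end Final

end

end CnoidalBBM

theorem lemma5p3 (L : ℝ) (hL : 4 * Real.pi < L) :
    ∃ kL ∈ Set.Ioo (0 : ℝ) 1,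
      (∀ k ∈ Set.Ioo (0 : ℝ) 1, CnoidalBBM.thresholdFun k = L ^ 2 ↔ k = kL) ∧
      ∀ k ∈ Set.Ioo (0 : ℝ) kL,
        -- the derivatives with respect to `k` that occur in the claim exist
        DifferentiableAt ℝ (CnoidalBBM.waveSpeed L) k ∧
        DifferentiableAt ℝ (CnoidalBBM.intConst L) k ∧
        (∀ x : ℝ, DifferentiableAt ℝ (fun κ => CnoidalBBM.wave L κ x) k) ∧
        ContDiff ℝ ∞ (CnoidalBBM.waveDk L k) ∧
        Function.Periodic (CnoidalBBM.waveDk L k) L ∧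
        -- the claim itself, with `G = M_k'(φ_k)`
        ∃ G : ℝ → ℝ,
          CnoidalBBM.HasGradientPer L (CnoidalBBM.functionalM L k) G (CnoidalBBM.wave L k) ∧
          CnoidalBBM.quantityPhi L k =
            -CnoidalBBM.innerPer L G (CnoidalBBM.waveDk L k) ∧
          CnoidalBBM.quantityPhi L k < 0 := by
  have hL0 : 0 < L := by linarith [Real.pi_pos]
  obtain ⟨kL, hkL, hthr⟩ := CnoidalBBM.exists_threshold_modulus hL
  refine ⟨kL, hkL, fun k hk => ⟨fun h => ?_, fun h => h ▸ hthr⟩, fun k hk => ?_⟩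
  · exact CnoidalBBM.strictMonoOn_thresholdFun.injOn hk hkL (h.trans hthr.symm)
  have hk1 : k ∈ Set.Ioo (0 : ℝ) 1 := ⟨hk.1, hk.2.trans hkL.2⟩
  have hadm : k ∈ CnoidalBBM.admissible L := by
    refine ⟨hk1, ?_⟩
    -- Monotonicity turns k < k_L into P(k) < L², that is, m̃(k) > 0.
    have := CnoidalBBM.strictMonoOn_thresholdFun hk1 hkL hk.2
    rw [CnoidalBBM.mTilde_eq]
    linarith
  have hphi : CnoidalBBM.quantityPhi L k =
      -CnoidalBBM.innerPer L (CnoidalBBM.gradM L k (CnoidalBBM.wave L k))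
        (CnoidalBBM.waveDk L k) := by
    rw [CnoidalBBM.quantityPhi, CnoidalBBM.innerPer, CnoidalBBM.innerPer,
      ← intervalIntegral.integral_neg]
    refine intervalIntegral.integral_congr fun x _ => ?_
    rw [CnoidalBBM.linOp_waveDk hL0.ne' hadm, CnoidalBBM.gradM, neg_mul]
  refine ⟨(CnoidalBBM.hasDerivAt_waveSpeed hadm).differentiableAt,
    (CnoidalBBM.hasDerivAt_intConst hadm).differentiableAt,
    fun x => (CnoidalBBM.hasDerivAt_wave_modulus hadm x).differentiableAt,
    CnoidalBBM.contDiff_waveDk hadm, CnoidalBBM.waveDk_periodic hL0.ne' hadm, _,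
    CnoidalBBM.hasGradientPer_functionalM hL0 (CnoidalBBM.contDiff_wave hadm)
      (CnoidalBBM.wave_periodic hL0.ne' hadm) k, hphi, ?_⟩
  rw [hphi]
  linarith [CnoidalBBM.quantity_pos hL0 hadm]
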